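/- A loopless multigraph on $V$ vertices assigns to each pair of distinct vertices a multiplicity in $\{0,1,2,\dots\}$ (the number of parallel undirected edges joining them); it is connected if its underlying simple graph (join two vertices iff their multiplicity is positive) is connected, and it has $E$ edges if its multiplicities add up to $E$. Let $c_V(E)$ be the number of unlabeled (i.e. up to relabeling of the vertices) connected loopless multigraphs with $V$ vertices and $E$ edges, and let $C_V(x)=\sum_{E\ge 0}c_V(E)x^E$ be the column generating function. For a simple graph $G$ on $V$ vertices let $$Z_G(t_1,t_2,\dots)=\frac1{|\mathrm{Aut}(G)|}\sum_{\varphi\in\mathrm{Aut}(G)}\ \prod_{i\ge1}t_i^{\,c_i(\varphi)},$$ where $c_i(\varphi)$ is the number of cycles of length $i$ (fixed points included for $i=1$) of the permutation that $\varphi$ induces on the edges of $G$. (a) For $V\in\{2,3,5,6,7\}$, $$C_V(x)=\sum_{G}Z_G\Big|_{t_i\mapsto x^i/(1-x^i)},$$ the sum being over all isomorphism classes of connected simple graphs $G$ on $V$ vertices. (b) As formal power series over $\mathbb{Q}$, $$C_2=\frac{x}{1-x},\qquad C_3=\frac{(x^3-x-1)x^2}{(x-1)^3(x+1)(x^2+x+1)},$$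 $$C_5=\frac{x^4p_5(x)}{(x-1)^{10}(x^2+x+1)^3(x+1)^4(x^2-x+1)(x^4+x^3+x^2+x+1)^2(x^2+1)^2},$$ $$C_6=-\frac{x^5p_6(x)}{(x-1)^{15}(x+1)^6(x^2+1)^3(x^2+x+1)^5(x^2-x+1)^2(x^4+x^3+x^2+x+1)^3},$$ and $C_7=x^6p_7(x)/q_7(x)$ with $$\begin{aligned}q_7={}&(x-1)^{21}(x^4+x^3+x^2+x+1)^4(x^2+x+1)^7(x+1)^9(x^2+1)^4(x^2-x+1)^3\\&\times(x^4-x^2+1)(x^4-x^3+x^2-x+1)(x^6+x^5+x^4+x^3+x^2+x+1)^3,\end{aligned}$$ where $p_5=3+5x+12x^{2}+17x^{3}+26x^{4}+27x^{5}+35x^{6}+28x^{7} +38x^{8}+30x^{9}+39x^{10}+37x^{11}+34x^{12}+24x^{13}+15x^{14}+3x^{15} -7x^{16}-9x^{17}-8x^{18}-x^{19}+4x^{20}+6x^{21}+5x^{22}+3x^{23} -2x^{24}-2x^{25}-2x^{26}-x^{27}+x^{29}$, $p_6=6+11x+35x^{2}+70x^{3}+134x^{4}+217x^{5}+348x^{6}+533x^{7}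 +726x^{8}+1038x^{9}+1290x^{10}+1629x^{11}+1810x^{12}+2040x^{13}+1976x^{14}+1984x^{15} +1696x^{16}+1542x^{17}+1206x^{18}+1050x^{19}+787x^{20}+636x^{21}+474x^{22}+273x^{23} +169x^{24}-11x^{25}-31x^{26}-97x^{27}-44x^{28}-8x^{29}+33x^{30}+63x^{31} +32x^{32}+38x^{33}-17x^{34}-14x^{35}-31x^{36}-8x^{37}-5x^{38}+8x^{39} +11x^{40}+4x^{41}+3x^{42}-4x^{43}-3x^{45}+x^{47} $, $p_7=-11-48x-188x^{2}-570x^{3}-1526x^{4}-3675x^{5}-8284x^{6}-17431x^{7} -35005x^{8}-66742x^{9}-121908x^{10}-213342x^{11}-359515x^{12}-583522x^{13}-916091x^{14}-1391716x^{15} -2051981x^{16}-2938963x^{17}-4097420x^{18}-5564508x^{19}-7373793x^{20}-9539279x^{21}-12063528x^{22}-14919997x^{23} -18064473x^{24}-21418776x^{25}-24890827x^{26}-28355984x^{27}-31688266x^{28}-34742272x^{29}-37387611x^{30}-39493274x^{31} -40963946x^{32}-41717383x^{33}-41723196x^{34}-40973187x^{35}-39511812x^{36}-37405689x^{37}-34764514x^{38}-31705308x^{39}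 -28372262x^{40}-24898844x^{41}-21423490x^{42}-18060699x^{43}-14913079x^{44}-12050303x^{45}-9525196x^{46}-7357519x^{47} -5550815x^{48}-4085547x^{49}-2932089x^{50}-2048825x^{51}-1393454x^{52}-920594x^{53}-590477x^{54}-366935x^{55} -220705x^{56}-128024x^{57}-71511x^{58}-37993x^{59}-18932x^{60}-8318x^{61}-2668x^{62}+247x^{63} +1501x^{64}+1827x^{65}+1523x^{66}+980x^{67}+357x^{68}-99x^{69}-369x^{70}-387x^{71} -247x^{72}-23x^{73}+152x^{74}+230x^{75}+205x^{76}+118x^{77}+15x^{78}-61x^{79} -88x^{80}-74x^{81}-33x^{82}+3x^{83}+26x^{84}+28x^{85}+19x^{86}+5x^{87} -4x^{88}-7x^{89}-5x^{90}-x^{91}+x^{92}+x^{93}$. (c) The first coefficients, starting at $E=0$, are - $V=2$: $0,1,1,1,1,1$; - $V=3$: $0,0,1,2,3,4,6,7,9,11,13,15,18,20,23$; - $V=5$: $0,0,0,0,3,11,34,85,193,396,771,1411,2490,4221$; - $V=6$: $0,0,0,0,0,6,29,110,348,969,2445,5746,12736,26843,54256,105669$; - $V=7$: $0,0,0,0,0,0,11,70,339,1318,4457,13572,38201,100622,251078$.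 -/

import Mathlib

/-- A loopless undirected multigraph on the vertex set `α`: the number of parallel edges joining
each unordered pair of vertices, with no edge joining a vertex to itself. Parallel edges are
indistinguishable, so this is a symmetric matrix over `ℕ` with zero diagonal. -/
@[ext]
structure LooplessMultigraph (α : Type*) where
  mult : Sym2 α → ℕ
  loopless : ∀ a : α, mult s(a, a) = 0

namespace LooplessMultigraph

variable {α : Type*}

/-- The total number of edges, counted with multiplicity. -/
def numEdges [Fintype α] [DecidableEq α] (M : LooplessMultigraph α) : ℕ :=
  ∑ e : Sym2 α, M.mult e

/-- The underlying simple graph, in which every multiedge is replaced by a single edge. -/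
def underlying (M : LooplessMultigraph α) : SimpleGraph α where
  Adj a b := M.mult s(a, b) ≠ 0
  symm := ⟨fun a b h => by rwa [Sym2.eq_swap]⟩
  loopless := ⟨fun a h => h (M.loopless a)⟩

/-- `M` and `N` differ only by a relabelling of the vertices. -/
def Iso (M N : LooplessMultigraph α) : Prop :=
  ∃ σ : Equiv.Perm α, ∀ a b : α, N.mult s(σ a, σ b) = M.mult s(a, b)

theorem Iso.refl (M : LooplessMultigraph α) : M.Iso M := ⟨1, fun _ _ => rfl⟩

theorem Iso.symm {M N : LooplessMultigraph α} : M.Iso N → N.Iso M := by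
  rintro ⟨σ, h⟩
  exact ⟨σ.symm, fun a b => by simpa using (h (σ.symm a) (σ.symm b)).symm⟩

theorem Iso.trans {M N P : LooplessMultigraph α} : M.Iso N → N.Iso P → M.Iso P := by
  rintro ⟨σ, h⟩ ⟨τ, k⟩
  exact ⟨σ.trans τ, fun a b => by simpa using (k (σ a) (σ b)).trans (h a b)⟩

end LooplessMultigraph

namespace ConnectedMultigraphs

open LooplessMultigraph

/-- The connected loopless multigraphs with vertex set `{0, …, V - 1}` and `E` edges, up to
relabelling of the vertices. -/
def multigraphSetoid (V E : ℕ) :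
    Setoid {M : LooplessMultigraph (Fin V) // M.underlying.Connected ∧ M.numEdges = E} where
  r M N := M.1.Iso N.1
  iseqv := ⟨fun M => Iso.refl M.1, Iso.symm, Iso.trans⟩

/-- The number of unlabeled connected loopless multigraphs with `V` vertices and `E` edges. -/
noncomputable def count (V E : ℕ) : ℕ := Nat.card (Quotient (multigraphSetoid V E))

/-- The column generating function `∑_E count(V, E) x^E`. -/
noncomputable def columnGF (V : ℕ) : PowerSeries ℚ := PowerSeries.mk fun E => (count V E : ℚ)

open Classical in
/-- The cycle index, in the variables `t₁, t₂, …`, of the automorphism group of `G` acting on the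
edges of `G`: the mean over all automorphisms `φ` of the product of `t_i` over the cycles of the
permutation of the edges induced by `φ`, where `i` is the length of the cycle. Cycles of length one
are included. -/
noncomputable def edgeCycleIndex {α : Type*} [Fintype α] (G : SimpleGraph α) : MvPolynomial ℕ ℚ :=
  MvPolynomial.C (Nat.card (G ≃g G) : ℚ)⁻¹ *
    ∑ᶠ φ : G ≃g G,
      ((Equiv.Perm.partition (φ.mapEdgeSet : Equiv.Perm G.edgeSet)).parts.map
        MvPolynomial.X).prod

/-- The Pólya substitution `t_i ↦ t(x^i) = x^i / (1 - x^i)`, where `t(x) = x / (1 - x)`, in the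
cycle index of `G`. -/
noncomputable def polyaSeries {α : Type*} [Fintype α] (G : SimpleGraph α) : PowerSeries ℚ :=
  MvPolynomial.aeval
    (fun i : ℕ => (PowerSeries.X ^ i * (1 - PowerSeries.X ^ i)⁻¹ : PowerSeries ℚ))
    (edgeCycleIndex G)

theorem partition_permCongr {β γ : Type*} [Fintype β] [DecidableEq β] [Fintype γ]
    [DecidableEq γ] (e : β ≃ γ) (σ : Equiv.Perm β) :
    (Equiv.Perm.partition (e.permCongr σ)).parts = (Equiv.Perm.partition σ).parts := by
  classical
  have h : e.permCongr σ =
      σ.extendDomain (p := fun _ : γ => True) (e.trans (Equiv.Set.univ γ).symm) := by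
    ext x
    rw [Equiv.Perm.extendDomain_apply_subtype _ _ trivial]
    rfl
  rw [Equiv.Perm.parts_partition, Equiv.Perm.parts_partition, h,
    Equiv.Perm.cycleType_extendDomain, Equiv.Perm.card_support_extend_domain,
    Fintype.card_congr e]

theorem edgeCycleIndex_congr {α : Type*} [Fintype α] {G H : SimpleGraph α} (e : G ≃g H) :
    edgeCycleIndex G = edgeCycleIndex H := by
  classical
  let c : (G ≃g G) ≃ (H ≃g H) :=
    { toFun := fun φ => (e.symm.trans φ).trans e
      invFun := fun ψ => (e.trans ψ).trans e.symm
      left_inv := fun φ => by ext x; simp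
      right_inv := fun ψ => by ext x; simp }
  unfold edgeCycleIndex
  rw [Nat.card_congr c, ← finsum_comp_equiv c]
  congr 1
  refine finsum_congr fun φ => ?_
  have h : ((c φ).mapEdgeSet : Equiv.Perm H.edgeSet) =
      e.mapEdgeSet.permCongr (φ.mapEdgeSet : Equiv.Perm G.edgeSet) := by
    refine Equiv.ext fun x => Subtype.ext ?_
    obtain ⟨x, hx⟩ := x
    induction x using Sym2.ind
    rfl
  rw [h, partition_permCongr e.mapEdgeSet]

/-- The automorphism group of a finite graph is finite, so that the sum above is a finite sum. -/
theorem finite_automorphisms {α : Type*} [Fintype α] (G : SimpleGraph α) : Finite (G ≃g G) :=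
  DFunLike.finite _

/-- The connected simple graphs with vertex set `{0, …, V - 1}`, up to isomorphism. -/
def simpleGraphSetoid (V : ℕ) : Setoid {G : SimpleGraph (Fin V) // G.Connected} where
  r G H := Nonempty (G.1 ≃g H.1)
  iseqv := ⟨fun _ => ⟨SimpleGraph.Iso.refl⟩, fun ⟨e⟩ => ⟨e.symm⟩, fun ⟨e⟩ ⟨f⟩ => ⟨e.trans f⟩⟩

/-- The sum of the Pólya substitutions over all isomorphism classes of connected simple graphs
with `V` vertices. -/
noncomputable def polyaSum (V : ℕ) : PowerSeries ℚ :=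
  ∑ᶠ c : Quotient (simpleGraphSetoid V),
    Quotient.lift (s := simpleGraphSetoid V) (fun G => polyaSeries G.1)
      (fun _ _ ⟨e⟩ => congrArg (MvPolynomial.aeval _) (edgeCycleIndex_congr e)) c

/-- The polynomial `c₀ + c₁ x + c₂ x² + ⋯` with the coefficient list `[c₀, c₁, c₂, …]`. -/
noncomputable def ofCoeffs (c : List ℚ) : Polynomial ℚ :=
  c.foldr (fun a p => Polynomial.C a + Polynomial.X * p) 0

/-- The numerator polynomial `p5`, of degree 29. -/
noncomputable def p5 : Polynomial ℚ := ofCoeffs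
  [3, 5, 12, 17, 26, 27, 35, 28, 38, 30, 39, 37, 34, 24, 15, 3, -7, -9, -8, -1, 4, 6, 5, 3, -2,
   -2, -2, -1, 0, 1]

/-- The numerator polynomial `p6`, of degree 47. -/
noncomputable def p6 : Polynomial ℚ := ofCoeffs
  [6, 11, 35, 70, 134, 217, 348, 533, 726, 1038, 1290, 1629, 1810, 2040, 1976, 1984, 1696,
   1542, 1206, 1050, 787, 636, 474, 273, 169, -11, -31, -97, -44, -8, 33, 63, 32, 38, -17, -14,
   -31, -8, -5, 8, 11, 4, 3, -4, 0, -3, 0, 1]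

/-- The numerator polynomial `p7`, of degree 93. -/
noncomputable def p7 : Polynomial ℚ := ofCoeffs
  [-11, -48, -188, -570, -1526, -3675, -8284, -17431, -35005, -66742, -121908, -213342,
   -359515, -583522, -916091, -1391716, -2051981, -2938963, -4097420, -5564508, -7373793,
   -9539279, -12063528, -14919997, -18064473, -21418776, -24890827, -28355984, -31688266,
   -34742272, -37387611, -39493274, -40963946, -41717383, -41723196, -40973187, -39511812,
   -37405689, -34764514, -31705308, -28372262, -24898844, -21423490, -18060699, -14913079,
   -12050303, -9525196, -7357519, -5550815, -4085547, -2932089, -2048825, -1393454, -920594,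
   -590477, -366935, -220705, -128024, -71511, -37993, -18932, -8318, -2668, 247, 1501, 1827,
   1523, 980, 357, -99, -369, -387, -247, -23, 152, 230, 205, 118, 15, -61, -88, -74, -33, 3,
   26, 28, 19, 5, -4, -7, -5, -1, 1, 1]

end ConnectedMultigraphs

/-!
A connected multigraph is a connected simple graph with a positive multiplicity on each edge. By
Burnside's lemma (`factorial_mul_columnGF`), `V! * C_V(x)` is the sum over all permutations `σ` of
the vertices of the generating function `fixGF σ` of the connected multigraphs invariant under `σ`.

*Pólya's formula.* An invariant assignment of positive multiplicities to the edges of a graph is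
constant on the cycles of the induced permutation of the edges, so that it is enumerated by one
factor `x^l / (1 - x^l)` for each cycle of length `l` (`mk_card_invariant`). Grouping the pairs of a
permutation and an invariant multigraph by the underlying graph `G` gives
`V! * C_V(x) = ∑ |Aut G| * Z_G`, over the labelled connected graphs `G` (`sum_fixGF`). The orders of
the automorphism groups in an isomorphism class add up to `V!` (`sum_card_automorphisms`), and the
sum over isomorphism classes results. This holds for every `V` (`columnGF_eq_polyaSum`).

*Closed forms.* The series `fixGF σ` depends only on the cycle type of `σ`, and the sizes of the
conjugacy classes are known, so that one representative of each class is sufficient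
(`IsComplete.sum_fixGF`). For a representative with orbits `o` on the pairs of vertices,
`fixGF σ * ∏ (1 - x^|o|)` is the polynomial
`∑_S ∏_{o ∈ S} x^|o| * ∏_{o ∉ S} (1 - x^|o|)`, where `S` runs over the sets of orbits whose union is
a connected graph (`IsOrbitList.fixGF_mul_prod`, `sum_selected_mul_prod`). For the identity on seven
vertices there are `2 ^ 21` sets of orbits, too many for an enumeration. The polynomial is computed
by dynamic programming instead: the orbits are considered one after the other, and all that has to
be remembered of those already considered is the partition of the vertices into connected
components, where vertices that no later orbit touches need not be told apart. The correctness proof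
(`ofInts_numerator`) rests on `Connecting`, which expresses connectedness by functions that are
constant along the edges: joining an edge to a partition amounts to merging two blocks
(`connecting_cons`), and a vertex without further edges may be moved to another block
(`connecting_update_iff`), or else is isolated (`not_connecting_of_isolated`).

It remains to compare polynomials with integer coefficients over the common denominator
(`IsCertificate.columnGF_mul`), which is done by evaluation in the kernel, and to read off the first
coefficients (`map_count_eq`).
-/

namespace ConnectedMultigraphs

open LooplessMultigraph PowerSeries

/-! ### Generating functions of weighted multiplicities -/

/-- The power series `x^l / (1 - x^l)` has coefficient one exactly at the positive multiples
of `l`. -/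
theorem coeff_pow_mul_inv {l : ℕ} (hl : 0 < l) (n : ℕ) :
    coeff n (X ^ l * (1 - X ^ l)⁻¹ : PowerSeries ℚ) = if l ∣ n ∧ n ≠ 0 then 1 else 0 := by
  have h0 : constantCoeff (1 - X ^ l : PowerSeries ℚ) ≠ 0 := by
    simp [hl.ne']
  have h : (PowerSeries.mk fun n => if l ∣ n ∧ n ≠ 0 then (1 : ℚ) else 0) =
      X ^ l * (1 - X ^ l)⁻¹ := by
    rw [PowerSeries.eq_mul_inv_iff_mul_eq h0]
    ext n
    rw [mul_sub, mul_one, map_sub, coeff_mul_X_pow', coeff_X_pow, coeff_mk]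
    rcases lt_trichotomy n l with h | rfl | h
    · have : ¬ (l ∣ n ∧ n ≠ 0) := fun hn => absurd (Nat.le_of_dvd (by omega) hn.1) (by omega)
      rw [if_neg this, if_neg (by omega), if_neg (by omega), sub_zero]
    · simp [hl.ne']
    · have h1 : (l ∣ n ∧ n ≠ 0) ↔ (l ∣ n - l ∧ n - l ≠ 0) := by
        rw [Nat.dvd_sub_self_right]
        constructor
        · rintro ⟨h1, -⟩
          exact ⟨Or.inl h1, by omega⟩
        · rintro ⟨h1 | h1, -⟩
          · exact ⟨h1, by omega⟩
          · omega
      rw [if_pos h.le, coeff_mk, if_neg (by omega : n ≠ l)]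
      simp only [h1, sub_self]
  rw [← h, coeff_mk]

/-- The coefficient of `x^E` on the right-hand side of `mk_card_weighted`, as the number of
pairs of a support `s` satisfying `P` and a family of weights summing to `E`. -/
theorem coeff_sum_supports {ι : Type*} [Fintype ι] [DecidableEq ι] (l : ι → ℕ)
    (hl : ∀ i, 0 < l i) (P : (ι → Bool) → Prop) [DecidablePred P] (E : ℕ) :
    (∑ s : ι → Bool, coeff E (if P s then
        ∏ i, (if s i then X ^ l i * (1 - X ^ l i)⁻¹ else 1) else 0 : PowerSeries ℚ)) =
      ((((Finset.univ : Finset (ι → Bool)) ×ˢ Finset.finsuppAntidiag Finset.univ E).filter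
        fun p => P p.1 ∧ ∀ i, l i ∣ p.2 i ∧ p.1 i = decide (p.2 i ≠ 0)).card : ℚ) := by
  have key : ∀ s : ι → Bool, ∀ f : ι →₀ ℕ,
      ∏ i, coeff (f i) (if s i then X ^ l i * (1 - X ^ l i)⁻¹ else 1 : PowerSeries ℚ) =
        if ∀ i, l i ∣ f i ∧ s i = decide (f i ≠ 0) then 1 else 0 := by
    intro s f
    rw [← Fintype.prod_boole]
    refine Finset.prod_congr rfl fun i _ => ?_
    cases h : s i
    · by_cases h0 : f i = 0 <;> simp [coeff_one, h0]
    · by_cases h0 : f i = 0 <;> simp [coeff_pow_mul_inv (hl i), h0]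
  rw [Finset.card_filter, Finset.sum_product]
  push_cast
  refine Finset.sum_congr rfl fun s _ => ?_
  by_cases hs : P s
  · rw [if_pos hs, PowerSeries.coeff_prod]
    refine Finset.sum_congr rfl fun f _ => ?_
    rw [key]
    simp only [hs, true_and]
  · simp [hs]

/-- Enumeration of the multiplicity functions `g : ι → ℕ` whose support satisfies `P`, by the
total weight `∑ l i * g i`: one factor `x^l / (1 - x^l)` for each index in the support. -/
theorem mk_card_weighted {ι : Type*} [Fintype ι] [DecidableEq ι] (l : ι → ℕ)
    (hl : ∀ i, 0 < l i) (P : (ι → Bool) → Prop) [DecidablePred P] :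
    (PowerSeries.mk fun E => (Nat.card {g : ι → ℕ //
        P (fun i => decide (g i ≠ 0)) ∧ ∑ i, l i * g i = E} : ℚ)) =
      ∑ s : ι → Bool, if P s then
        ∏ i, (if s i then X ^ l i * (1 - X ^ l i)⁻¹ else 1) else 0 := by
  ext E
  rw [coeff_mk, map_sum]
  rw [coeff_sum_supports l hl, Nat.cast_inj]
  set T := ((Finset.univ : Finset (ι → Bool)) ×ˢ Finset.finsuppAntidiag Finset.univ E).filter
    fun p => P p.1 ∧ ∀ i, l i ∣ p.2 i ∧ p.1 i = decide (p.2 i ≠ 0) with hT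
  have mem (p : (ι → Bool) × (ι →₀ ℕ)) : p ∈ T ↔
      (∑ i, p.2 i = E ∧ P p.1) ∧ ∀ i, l i ∣ p.2 i ∧ p.1 i = decide (p.2 i ≠ 0) := by
    simp [hT, and_assoc]
  clear_value T
  rw [← Nat.subtype_card T mem]
  have h1 (i : ι) (n : ℕ) : l i * n ≠ 0 ↔ n ≠ 0 := by simp [(hl i).ne']
  refine Nat.card_congr (Equiv.ofBijective
    (fun g => ⟨(fun i => decide (g.1 i ≠ 0),
          Finsupp.equivFunOnFinite.symm fun i => l i * g.1 i), ?_⟩) ⟨?_, ?_⟩)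
  · obtain ⟨g, hP, hg⟩ := g
    simp only [Finsupp.equivFunOnFinite_symm_apply_apply, h1, hP, hg, dvd_mul_right, and_self,
      implies_true]
  · intro g g' h
    have h2 := Finsupp.equivFunOnFinite.symm.injective (congrArg (fun p => p.1.2) h)
    refine Subtype.ext (funext fun i => ?_)
    exact Nat.eq_of_mul_eq_mul_left (hl i) (congrFun h2 i)
  · rintro ⟨⟨s, f⟩, ⟨hE, hP⟩, hd⟩
    have hs (i : ι) : s i = decide (f i ≠ 0) := (hd i).2
    choose g hg using fun i => show l i ∣ f i from (hd i).1
    simp only at hE hP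
    have hs' : (fun i => decide (g i ≠ 0)) = s := by
      funext i
      simp only [hs, hg, h1]
    refine ⟨⟨g, by rwa [hs'], ?_⟩, ?_⟩
    · rw [← hE]
      exact Finset.sum_congr rfl fun i _ => (hg i).symm
    · refine Subtype.ext (Prod.ext hs' (Finsupp.ext fun i => ?_))
      exact (hg i).symm

/-! ### Burnside's lemma for connected multigraphs -/

section Burnside

variable {α : Type*}

/-- Relabelling the vertices of a multigraph. -/
instance : MulAction (Equiv.Perm α) (LooplessMultigraph α) where
  smul σ M := ⟨fun e => M.mult (e.map σ.symm), fun a => M.loopless (σ.symm a)⟩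
  one_smul M := by
    ext e
    exact congrArg M.mult (Sym2.map_id' ▸ rfl : e.map (fun x => x) = e)
  mul_smul σ τ M := by
    ext e
    exact congrArg M.mult (Sym2.map_map (g := τ.symm) (f := σ.symm) e).symm

theorem smul_mult (σ : Equiv.Perm α) (M : LooplessMultigraph α) (e : Sym2 α) :
    (σ • M).mult e = M.mult (e.map σ.symm) := rfl

theorem smul_mult_map (σ : Equiv.Perm α) (M : LooplessMultigraph α) (e : Sym2 α) :
    (σ • M).mult (e.map σ) = M.mult e := by
  rw [smul_mult, Sym2.map_map]
  simp

theorem smul_eq_iff {σ : Equiv.Perm α} {M N : LooplessMultigraph α} :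
    σ • M = N ↔ ∀ e, N.mult (e.map σ) = M.mult e := by
  constructor
  · rintro rfl e
    exact smul_mult_map σ M e
  · intro h
    ext e
    rw [smul_mult, ← h, Sym2.map_map]
    simp

theorem smul_eq_iff' {σ : Equiv.Perm α} {M N : LooplessMultigraph α} :
    σ • M = N ↔ ∀ a b, N.mult s(σ a, σ b) = M.mult s(a, b) := by
  rw [smul_eq_iff]
  exact ⟨fun h a b => h s(a, b), fun h e => Sym2.ind h e⟩

/-- The underlying graphs of `M` and of a relabelling of `M` are isomorphic. -/
def underlyingIso (σ : Equiv.Perm α) (M : LooplessMultigraph α) :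
    M.underlying ≃g (σ • M).underlying where
  toEquiv := σ
  map_rel_iff' := by
    intro a b
    exact not_congr (by rw [← smul_eq_iff'.1 (rfl : σ • M = σ • M) a b])

variable [Fintype α] [DecidableEq α]

theorem numEdges_smul (σ : Equiv.Perm α) (M : LooplessMultigraph α) :
    (σ • M).numEdges = M.numEdges :=
  (Sym2.map.injective σ.symm.injective).bijective_of_finite.sum_comp M.mult

theorem finite_numEdges_eq (E : ℕ) : Finite {M : LooplessMultigraph α // M.numEdges = E} := by
  have h (M : {M : LooplessMultigraph α // M.numEdges = E}) (e : Sym2 α) :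
      M.1.mult e < E + 1 := by
    obtain ⟨M, rfl⟩ := M
    exact Nat.lt_succ_of_le (Finset.single_le_sum (fun _ _ => Nat.zero_le _) (Finset.mem_univ e))
  refine Finite.of_injective (β := Sym2 α → Fin (E + 1)) (fun M e => ⟨M.1.mult e, h M e⟩) ?_
  intro M N hMN
  refine Subtype.ext (LooplessMultigraph.ext (funext fun e => ?_))
  exact congrArg Fin.val (congrFun hMN e)

/-- The connected multigraphs with `E` edges, a set on which the permutations of the vertices
act. -/
abbrev ConnectedWith (α : Type*) [Fintype α] [DecidableEq α] (E : ℕ) :=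
  {M : LooplessMultigraph α // M.underlying.Connected ∧ M.numEdges = E}

instance (E : ℕ) : Finite (ConnectedWith α E) :=
  haveI := finite_numEdges_eq (α := α) E
  Finite.of_injective (β := {M : LooplessMultigraph α // M.numEdges = E})
    (fun M => ⟨M.1, M.2.2⟩) fun _ _ h => Subtype.ext (Subtype.mk.inj h)

instance (E : ℕ) : MulAction (Equiv.Perm α) (ConnectedWith α E) where
  smul σ M := ⟨σ • M.1, (underlyingIso σ M.1).connected_iff.1 M.2.1, by
    rw [numEdges_smul, M.2.2]⟩
  one_smul M := Subtype.ext (one_smul _ M.1)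
  mul_smul σ τ M := Subtype.ext (mul_smul σ τ M.1)

/-- The number of connected multigraphs with `E` edges that are invariant under `σ`. -/
noncomputable def fixCount (σ : Equiv.Perm α) (E : ℕ) : ℕ :=
  Nat.card {M : LooplessMultigraph α // (M.underlying.Connected ∧ M.numEdges = E) ∧ σ • M = M}

/-- The generating function by the number of edges of the connected multigraphs invariant
under `σ`. -/
noncomputable def fixGF (σ : Equiv.Perm α) : PowerSeries ℚ :=
  PowerSeries.mk fun E => (fixCount σ E : ℚ)

theorem card_fixedBy (σ : Equiv.Perm α) (E : ℕ) :
    Nat.card (MulAction.fixedBy (ConnectedWith α E) σ) = fixCount σ E := by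
  refine Nat.card_congr ((Equiv.subtypeEquivRight fun M => ?_).trans
    (Equiv.subtypeSubtypeEquivSubtypeInter _ fun M => σ • M = M))
  exact Subtype.ext_iff

end Burnside

theorem count_mul_factorial (V E : ℕ) :
    count V E * V.factorial = ∑ σ : Equiv.Perm (Fin V), fixCount σ E := by
  classical
  have hs : multigraphSetoid V E =
      MulAction.orbitRel (Equiv.Perm (Fin V)) (ConnectedWith (Fin V) E) := by
    refine Setoid.ext fun M N => ?_
    rw [MulAction.orbitRel_apply, MulAction.mem_orbit_symm, MulAction.mem_orbit_iff]
    simp only [Subtype.ext_iff]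
    exact exists_congr fun σ => smul_eq_iff'.symm
  have : Fintype (ConnectedWith (Fin V) E) := Fintype.ofFinite _
  have h := MulAction.sum_card_fixedBy_eq_card_orbits_mul_card_group
    (Equiv.Perm (Fin V)) (ConnectedWith (Fin V) E)
  rw [Fintype.card_perm, Fintype.card_fin] at h
  rw [count, hs, Nat.card_eq_fintype_card, ← h]
  refine Finset.sum_congr rfl fun σ _ => ?_
  rw [← card_fixedBy, Nat.card_eq_fintype_card]

/-- Burnside's lemma for the column generating function. -/
theorem factorial_mul_columnGF (V : ℕ) :
    C (V.factorial : ℚ) * columnGF V = ∑ σ : Equiv.Perm (Fin V), fixGF σ := by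
  ext E
  rw [coeff_C_mul, map_sum, columnGF, coeff_mk, mul_comm]
  simp only [fixGF, coeff_mk]
  exact_mod_cast count_mul_factorial V E

/-! ### Pólya's formula -/

section Cycles

open Classical in
/-- The index of the cycle of `τ` that contains `b`; the fixed points are listed apart. -/
noncomputable def cycleIndexOf {β : Type*} [Fintype β] [DecidableEq β] (τ : Equiv.Perm β) (b : β) :
    {c // c ∈ τ.cycleFactorsFinset} ⊕ {b // τ b = b} :=
  if h : τ b = b then .inr ⟨b, h⟩
  else .inl ⟨τ.cycleOf b,
    Equiv.Perm.cycleOf_mem_cycleFactorsFinset_iff.2 (Equiv.Perm.mem_support.2 h)⟩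

variable {β : Type*} [Fintype β] [DecidableEq β] {τ : Equiv.Perm β}

theorem cycleIndexOf_eq_inl {b : β} {c : {c // c ∈ τ.cycleFactorsFinset}} :
    cycleIndexOf τ b = .inl c ↔ b ∈ c.1.support := by
  unfold cycleIndexOf
  split_ifs with h
  · refine iff_of_false (by simp) fun hb => ?_
    exact Equiv.Perm.mem_support.1
      (Equiv.Perm.mem_cycleFactorsFinset_support_le c.2 hb) h
  · rw [Sum.inl.injEq, Subtype.ext_iff]
    constructor
    · intro h1
      rw [← h1, Equiv.Perm.mem_support_cycleOf_iff]
      exact ⟨.refl _ _, Equiv.Perm.mem_support.2 h⟩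
    · intro h1
      exact (Equiv.Perm.cycle_is_cycleOf h1 c.2).symm

theorem cycleIndexOf_eq_inr {b : β} {d : {b // τ b = b}} :
    cycleIndexOf τ b = .inr d ↔ b = d.1 := by
  unfold cycleIndexOf
  split_ifs with h
  · rw [Sum.inr.injEq, Subtype.ext_iff]
  · refine iff_of_false (by simp) ?_
    rintro rfl
    exact h d.2

theorem cycleIndexOf_surjective : Function.Surjective (cycleIndexOf τ) := by
  rintro (c | d)
  · obtain ⟨b, hb⟩ := (Equiv.Perm.mem_cycleFactorsFinset_iff.1 c.2).1.nonempty_support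
    exact ⟨b, cycleIndexOf_eq_inl.2 hb⟩
  · exact ⟨d.1, cycleIndexOf_eq_inr.2 rfl⟩

theorem cycleIndexOf_apply (b : β) : cycleIndexOf τ (τ b) = cycleIndexOf τ b := by
  rcases h : cycleIndexOf τ b with c | d
  · rw [cycleIndexOf_eq_inl] at h ⊢
    obtain ⟨hc, hcτ⟩ := Equiv.Perm.mem_cycleFactorsFinset_iff.1 c.2
    rw [← hcτ b h, Equiv.Perm.apply_mem_support]
    exact h
  · rw [cycleIndexOf_eq_inr] at h ⊢
    rw [h, d.2]

theorem sameCycle_of_cycleIndexOf_eq {b b' : β} (h : cycleIndexOf τ b = cycleIndexOf τ b') :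
    τ.SameCycle b b' := by
  rcases h' : cycleIndexOf τ b' with c | d
  · rw [h', cycleIndexOf_eq_inl] at h
    rw [cycleIndexOf_eq_inl, Equiv.Perm.cycle_is_cycleOf h c.2,
      Equiv.Perm.mem_support_cycleOf_iff] at h'
    exact h'.1
  · rw [h', cycleIndexOf_eq_inr] at h
    rw [cycleIndexOf_eq_inr] at h'
    rw [h, h']

/-- The number of elements of a cycle. -/
noncomputable def cycleLength (τ : Equiv.Perm β)
    (i : {c // c ∈ τ.cycleFactorsFinset} ⊕ {b // τ b = b}) : ℕ :=
  (Finset.univ.filter fun b => cycleIndexOf τ b = i).card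

theorem cycleLength_pos (i : {c // c ∈ τ.cycleFactorsFinset} ⊕ {b // τ b = b}) :
    0 < cycleLength τ i := by
  obtain ⟨b, hb⟩ := cycleIndexOf_surjective i
  exact Finset.card_pos.2 ⟨b, by simpa using hb⟩

theorem prod_cycleLength {R : Type*} [CommMonoid R] (t : ℕ → R) :
    ∏ i, t (cycleLength τ i) = (τ.partition.parts.map t).prod := by
  have hinl (c : {c // c ∈ τ.cycleFactorsFinset}) : cycleLength τ (.inl c) = c.1.support.card := by
    refine congrArg Finset.card (Finset.ext fun b => ?_)
    rw [Finset.mem_filter, cycleIndexOf_eq_inl]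
    exact and_iff_right (Finset.mem_univ b)
  have hinr (d : {b // τ b = b}) : cycleLength τ (.inr d) = 1 := by
    refine Finset.card_eq_one.2 ⟨d.1, Finset.ext fun b => ?_⟩
    rw [Finset.mem_filter, cycleIndexOf_eq_inr, Finset.mem_singleton]
    exact and_iff_right (Finset.mem_univ b)
  have hfix : Fintype.card {b // τ b = b} = Fintype.card β - τ.support.card := by
    rw [← Finset.card_compl, Fintype.card_subtype]
    congr 1
    ext b
    rw [Finset.mem_compl, Equiv.Perm.mem_support, not_not, Finset.mem_filter]
    exact and_iff_right (Finset.mem_univ b)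
  rw [Fintype.prod_sum_type, Equiv.Perm.parts_partition, Multiset.map_add, Multiset.prod_add,
    Multiset.map_replicate, Multiset.prod_replicate, Equiv.Perm.cycleType_def, Multiset.map_map]
  simp only [hinl, hinr, Finset.prod_const, Finset.card_univ, hfix]
  congr 1
  exact Finset.prod_coe_sort τ.cycleFactorsFinset fun c => t c.support.card

/-- Enumeration by their sum of the positive functions invariant under a permutation: one factor
`x^l / (1 - x^l)` for each cycle, of length `l`. -/
theorem mk_card_invariant (τ : Equiv.Perm β) :
    (PowerSeries.mk fun E => (Nat.card {f : β → ℕ //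
      (∀ b, f b ≠ 0) ∧ (∀ b, f (τ b) = f b) ∧ ∑ b, f b = E} : ℚ)) =
      (τ.partition.parts.map fun l => (X ^ l * (1 - X ^ l)⁻¹ : PowerSeries ℚ)).prod := by
  classical
  rw [← prod_cycleLength]
  have h1 := mk_card_weighted (cycleLength τ) cycleLength_pos (fun s => ∀ i, s i = true)
  -- all values are positive, so that every cycle belongs to the support
  rw [Finset.sum_eq_single (fun _ => true) (fun s _ hs => if_neg fun h => hs (funext h))
    (fun h => absurd (Finset.mem_univ _) h)] at h1
  simp only [implies_true, if_true] at h1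
  rw [← h1]
  congr 1
  funext E
  rw [Nat.cast_inj]
  have hsum (g : {c // c ∈ τ.cycleFactorsFinset} ⊕ {b // τ b = b} → ℕ) :
      ∑ b, g (cycleIndexOf τ b) = ∑ i, cycleLength τ i * g i := by
    rw [← Finset.sum_fiberwise (s := Finset.univ) (g := cycleIndexOf τ)]
    refine Finset.sum_congr rfl fun i _ => ?_
    rw [Finset.sum_congr rfl fun b hb => by rw [(Finset.mem_filter.1 hb).2], Finset.sum_const,
      smul_eq_mul, cycleLength]
  refine (Nat.card_congr (Equiv.ofBijective (fun g => ⟨fun b => g.1 (cycleIndexOf τ b),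
    fun b => of_decide_eq_true (g.2.1 _), fun b => congrArg g.1 (cycleIndexOf_apply b),
    (hsum _).trans g.2.2⟩) ⟨fun g g' h => ?_, ?_⟩)).symm
  · refine Subtype.ext (funext fun i => ?_)
    obtain ⟨b, rfl⟩ := cycleIndexOf_surjective i
    exact congrFun (Subtype.mk.inj h) b
  · rintro ⟨f, hpos, hinv, hE⟩
    -- an invariant function is constant on the cycles, hence a function of the cycle index
    have hconst (b b' : β) (h : cycleIndexOf τ b = cycleIndexOf τ b') : f b = f b' := by
      obtain ⟨n, -, rfl⟩ := (sameCycle_of_cycleIndexOf_eq h).exists_pow_eq'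
      clear h
      induction n with
      | zero => rfl
      | succ n ih => rw [pow_succ', Equiv.Perm.mul_apply, hinv, ← ih]
    let r := Function.surjInv (cycleIndexOf_surjective (τ := τ))
    have hr (b : β) : f (r (cycleIndexOf τ b)) = f b :=
      hconst _ _ (Function.surjInv_eq cycleIndexOf_surjective _)
    refine ⟨⟨fun i => f (r i), fun i => decide_eq_true (hpos _), ?_⟩, ?_⟩
    · rw [← hsum fun i => f (r i), ← hE]
      exact Finset.sum_congr rfl fun b _ => hr b
    · exact Subtype.ext (funext hr)

end Cycles

theorem finite_sum_eq {β : Type*} [Fintype β] (P Q : (β → ℕ) → Prop) (E : ℕ) :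
    Finite {f : β → ℕ // P f ∧ Q f ∧ ∑ b, f b = E} := by
  refine Finite.of_injective (β := β → Fin (E + 1))
    (fun f b => ⟨f.1 b, Nat.lt_succ_of_le ?_⟩) fun f f' h => ?_
  · exact (Finset.single_le_sum (f := f.1) (fun _ _ => Nat.zero_le _)
      (Finset.mem_univ b)).trans_eq f.2.2.2
  · exact Subtype.ext (funext fun b => congrArg Fin.val (congrFun h b))

open Classical in
/-- The multigraph supported on the edges of `G` with the given multiplicities. -/
noncomputable def ofEdges {α : Type*} (G : SimpleGraph α) (f : G.edgeSet → ℕ) :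
    LooplessMultigraph α where
  mult e := if h : e ∈ G.edgeSet then f ⟨e, h⟩ else 0
  loopless a := dif_neg (by simp)

theorem ofEdges_mult {α : Type*} {G : SimpleGraph α} (f : G.edgeSet → ℕ) (e : G.edgeSet) :
    (ofEdges G f).mult e = f e :=
  dif_pos e.2

theorem ofEdges_mult_of_notMem {α : Type*} {G : SimpleGraph α} (f : G.edgeSet → ℕ) {e : Sym2 α}
    (he : e ∉ G.edgeSet) : (ofEdges G f).mult e = 0 :=
  dif_neg he

section Polya

variable {α : Type*} [Fintype α]

open Classical in
/-- The cycle index of a graph, with denominators cleared, after Pólya's substitution. -/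
theorem card_mul_polyaSeries (G : SimpleGraph α) [Fintype (G ≃g G)] :
    C (Nat.card (G ≃g G) : ℚ) * polyaSeries G = ∑ φ : G ≃g G,
      ((Equiv.Perm.partition (φ.mapEdgeSet : Equiv.Perm G.edgeSet)).parts.map
        fun l => (X ^ l * (1 - X ^ l)⁻¹ : PowerSeries ℚ)).prod := by
  have : Nonempty (G ≃g G) := ⟨.refl⟩
  have h0 : (Nat.card (G ≃g G) : ℚ) ≠ 0 := by exact_mod_cast Nat.card_pos.ne'
  have h1 : MvPolynomial.C (Nat.card (G ≃g G) : ℚ) * edgeCycleIndex G = ∑ φ : G ≃g G,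
      ((Equiv.Perm.partition (φ.mapEdgeSet : Equiv.Perm G.edgeSet)).parts.map
        MvPolynomial.X).prod := by
    rw [edgeCycleIndex, ← mul_assoc, ← map_mul, mul_inv_cancel₀ h0, map_one, one_mul,
      finsum_eq_sum_of_fintype]
  have h2 := congrArg (MvPolynomial.aeval
    (fun i : ℕ => (PowerSeries.X ^ i * (1 - PowerSeries.X ^ i)⁻¹ : PowerSeries ℚ))) h1
  rw [map_mul, MvPolynomial.aeval_C, map_sum] at h2
  simp only [map_multiset_prod, Multiset.map_map, Function.comp_def, MvPolynomial.aeval_X] at h2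
  exact h2

variable {G : SimpleGraph α}

theorem underlying_ofEdges {α : Type*} {G : SimpleGraph α} {f : G.edgeSet → ℕ}
    (hf : ∀ e, f e ≠ 0) : (ofEdges G f).underlying = G := by
  ext a b
  change (ofEdges G f).mult s(a, b) ≠ 0 ↔ _
  by_cases h : G.Adj a b
  · simpa only [ofEdges_mult f ⟨s(a, b), h⟩, h, iff_true] using hf _
  · simp only [ofEdges_mult_of_notMem f (e := s(a, b)) h, h, ne_eq, not_true]

theorem smul_ofEdges_iff {α : Type*} {G : SimpleGraph α} {f : G.edgeSet → ℕ} (φ : G ≃g G) :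
    φ.toEquiv • ofEdges G f = ofEdges G f ↔ ∀ e, f (φ.mapEdgeSet e) = f e := by
  rw [smul_eq_iff]
  have h (e : G.edgeSet) : (φ.mapEdgeSet e : Sym2 α) = (e : Sym2 α).map φ.toEquiv := rfl
  constructor
  · intro h1 e
    rw [← ofEdges_mult f e, ← ofEdges_mult f (φ.mapEdgeSet e), h, h1]
  · intro h1 e
    by_cases he : e ∈ G.edgeSet
    · have h2 := h1 ⟨e, he⟩
      rwa [← ofEdges_mult f ⟨e, he⟩, ← ofEdges_mult f (φ.mapEdgeSet _), h] at h2
    · rw [ofEdges_mult_of_notMem f he, ofEdges_mult_of_notMem]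
      intro h2
      refine he ?_
      induction e using Sym2.ind with
      | _ a b => exact φ.map_rel_iff.1 h2

variable [DecidableEq α]

theorem numEdges_ofEdges (f : G.edgeSet → ℕ) [Fintype G.edgeSet] :
    (ofEdges G f).numEdges = ∑ e, f e := by
  unfold numEdges
  rw [← Finset.sum_subset (Finset.subset_univ G.edgeFinset) fun e _ he =>
      ofEdges_mult_of_notMem f (by simpa using he),
    Finset.sum_subtype G.edgeFinset (p := (· ∈ G.edgeSet)) fun _ => SimpleGraph.mem_edgeFinset]
  exact Finset.sum_congr (by congr) fun e _ => ofEdges_mult f e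

/-- The pairs of a permutation and an invariant connected multigraph with `E` edges. -/
abbrev FixedPair (α : Type*) [Fintype α] [DecidableEq α] (E : ℕ) :=
  {p : Equiv.Perm α × LooplessMultigraph α //
    (p.2.underlying.Connected ∧ p.2.numEdges = E) ∧ p.1 • p.2 = p.2}

instance (E : ℕ) : Finite (FixedPair α E) :=
  Finite.of_injective (β := Equiv.Perm α × ConnectedWith α E)
    (fun p => (p.1.1, ⟨p.1.2, p.2.1⟩)) fun p p' h => by
      rw [Prod.mk.injEq, Subtype.mk.injEq] at h
      exact Subtype.ext (Prod.ext h.1 h.2)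

theorem sum_fixCount (E : ℕ) : ∑ σ : Equiv.Perm α, fixCount σ E = Nat.card (FixedPair α E) := by
  have (σ : Equiv.Perm α) : Finite {p : FixedPair α E // p.1.1 = σ} := inferInstance
  rw [Nat.card_congr (Equiv.sigmaFiberEquiv fun p : FixedPair α E => p.1.1).symm, Nat.card_sigma]
  refine Finset.sum_congr rfl fun σ _ => Nat.card_congr (Equiv.ofBijective
    (fun M => ⟨⟨(σ, M.1), M.2⟩, rfl⟩) ⟨fun M N h => ?_, ?_⟩)
  · have h1 := congrArg (fun x => x.1.1.2) h
    exact Subtype.ext h1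
  · rintro ⟨⟨⟨σ, M⟩, hM⟩, rfl⟩
    exact ⟨⟨M, hM⟩, rfl⟩

/-- The fixed pairs with underlying graph `G` consist of an automorphism of `G` and an invariant
assignment of positive multiplicities to the edges of `G`. -/
theorem card_fixedPair_underlying [Fintype G.edgeSet] (hG : G.Connected) (E : ℕ) :
    Nat.card {p : FixedPair α E // p.1.2.underlying = G} =
      Nat.card (Σ φ : G ≃g G, {f : G.edgeSet → ℕ //
        (∀ e, f e ≠ 0) ∧ (∀ e, f (φ.mapEdgeSet e) = f e) ∧ ∑ e, f e = E}) := by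
  refine (Nat.card_congr (Equiv.ofBijective (fun x => ⟨⟨(x.1.toEquiv, ofEdges G x.2.1),
    ⟨by rwa [underlying_ofEdges x.2.2.1], (numEdges_ofEdges _).trans x.2.2.2.2⟩,
    (smul_ofEdges_iff x.1).2 x.2.2.2.1⟩, underlying_ofEdges x.2.2.1⟩) ⟨?_, ?_⟩)).symm
  · rintro ⟨φ, f, hf⟩ ⟨φ', f', hf'⟩ h
    have h1 : φ.toEquiv = φ'.toEquiv := congrArg (fun x => x.1.1.1) h
    have h2 : ofEdges G f = ofEdges G f' := congrArg (fun x => x.1.1.2) h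
    obtain rfl : φ = φ' := RelIso.toEquiv_injective h1
    obtain rfl : f = f' := funext fun e => by rw [← ofEdges_mult f, h2, ofEdges_mult]
    rfl
  · rintro ⟨⟨⟨σ, M⟩, ⟨hc, hE⟩, hM⟩, rfl⟩
    let φ : M.underlying ≃g M.underlying :=
      { toEquiv := σ
        map_rel_iff' := fun {a b} => not_congr (by rw [smul_eq_iff'.1 hM a b]) }
    have hpos (e : M.underlying.edgeSet) : M.mult e ≠ 0 := by
      obtain ⟨e, he⟩ := e
      induction e using Sym2.ind with
      | _ a b => exact he
    have hof : ofEdges M.underlying (fun e => M.mult e) = M := by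
      ext e
      by_cases he : e ∈ M.underlying.edgeSet
      · exact ofEdges_mult (G := M.underlying) (fun e => M.mult e) ⟨e, he⟩
      · rw [ofEdges_mult_of_notMem _ he]
        induction e using Sym2.ind with
        | _ a b => exact (not_not.1 he).symm
    have hinv := (smul_ofEdges_iff φ (f := fun e => M.mult e)).1 (by rwa [hof])
    have hsum := numEdges_ofEdges (G := M.underlying) (fun e => M.mult e)
    rw [hof] at hsum
    exact ⟨⟨φ, ⟨fun e => M.mult e, hpos, hinv, hsum.symm.trans hE⟩⟩,
      Subtype.ext (Subtype.ext (Prod.ext rfl hof))⟩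

open Classical in
/-- The pairs of a permutation and an invariant connected multigraph, grouped by the underlying
graph. -/
theorem sum_fixGF : ∑ σ : Equiv.Perm α, fixGF σ =
    ∑ G : {G : SimpleGraph α // G.Connected},
      C (Nat.card (G.1 ≃g G.1) : ℚ) * polyaSeries G.1 := by
  have : ∀ G : SimpleGraph α, Finite (G ≃g G) := finite_automorphisms
  have : ∀ G : SimpleGraph α, Fintype (G ≃g G) := fun G => Fintype.ofFinite _
  ext E
  rw [map_sum, map_sum]
  simp only [fixGF, coeff_mk, card_mul_polyaSeries, map_sum, ← mk_card_invariant]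
  rw [← Nat.cast_sum, sum_fixCount]
  let u (p : FixedPair α E) : {G : SimpleGraph α // G.Connected} := ⟨p.1.2.underlying, p.2.1.1⟩
  have hfin (G : {G : SimpleGraph α // G.Connected}) : Finite {p : FixedPair α E // u p = G} :=
    inferInstance
  rw [Nat.card_congr (Equiv.sigmaFiberEquiv u).symm, Nat.card_sigma, Nat.cast_sum]
  refine Finset.sum_congr rfl fun G _ => ?_
  have hu : Nat.card {p : FixedPair α E // u p = G} =
      Nat.card {p : FixedPair α E // p.1.2.underlying = G.1} :=
    Nat.card_congr (Equiv.subtypeEquivRight fun p => Subtype.ext_iff)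
  have hf (φ : G.1 ≃g G.1) := finite_sum_eq (fun f : G.1.edgeSet → ℕ => ∀ e, f e ≠ 0)
    (fun f => ∀ e, f (φ.mapEdgeSet e) = f e) E
  rw [hu, card_fixedPair_underlying G.2, Nat.card_sigma, Nat.cast_sum]

end Polya

/-- The automorphism groups of the graphs with vertex set `{0, …, V - 1}` in an isomorphism class
have `V!` elements in total. -/
theorem sum_card_automorphisms {V : ℕ} [Fintype {G : SimpleGraph (Fin V) // G.Connected}]
    [DecidableEq (Quotient (simpleGraphSetoid V))] (c : Quotient (simpleGraphSetoid V)) :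
    ∑ G ∈ (Finset.univ.filter fun G => Quotient.mk (simpleGraphSetoid V) G = c),
      Nat.card (G.1 ≃g G.1) = V.factorial := by
  classical
  obtain ⟨H, rfl⟩ := Quotient.exists_rep c
  have hcard : Nat.card (Equiv.Perm (Fin V)) = V.factorial := by
    rw [Nat.card_eq_fintype_card, Fintype.card_perm, Fintype.card_fin]
  have hfin (G : SimpleGraph (Fin V)) : Finite (H.1 ≃g G) := DFunLike.finite _
  rw [Finset.sum_subtype (p := fun G => Nonempty (G.1 ≃g H.1)) _
    (fun G => (Finset.mem_filter.trans (and_iff_right (Finset.mem_univ G))).trans Quotient.eq),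
    ← hcard]
  have h1 (G : {G : {G : SimpleGraph (Fin V) // G.Connected} // Nonempty (G.1 ≃g H.1)}) :
      Nat.card (G.1.1 ≃g G.1.1) = Nat.card (H.1 ≃g G.1.1) := by
    obtain ⟨e⟩ := G.2
    exact Nat.card_congr
      { toFun := fun φ => e.symm.trans φ
        invFun := fun φ => e.trans φ
        left_inv := fun φ => by ext x; simp
        right_inv := fun φ => by ext x; simp }
  rw [Finset.sum_congr rfl fun G _ => h1 G, ← Nat.card_sigma]
  refine Nat.card_congr (Equiv.ofBijective (fun x => x.2.toEquiv) ⟨?_, fun σ => ?_⟩)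
  · rintro ⟨⟨⟨G, hG⟩, hGH⟩, φ⟩ ⟨⟨⟨G', hG'⟩, hGH'⟩, φ'⟩ (h : φ.toEquiv = φ'.toEquiv)
    obtain rfl : G = G' := by
      ext a b
      have h1 := φ.symm.map_rel_iff (a := a) (b := b)
      have h2 := φ'.symm.map_rel_iff (a := a) (b := b)
      have h3 (x : Fin V) : φ.symm x = φ'.symm x :=
        congrArg (fun e : Equiv.Perm (Fin V) => e.symm x) h
      rw [← h1, ← h2, h3, h3]
    obtain rfl : φ = φ' := RelIso.toEquiv_injective h
    rfl
  · let e := SimpleGraph.Iso.map σ H.1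
    exact ⟨⟨⟨⟨_, e.connected_iff.1 H.2⟩, ⟨e.symm⟩⟩, e⟩, rfl⟩

/-- Pólya's formula for connected multigraphs. -/
theorem columnGF_eq_polyaSum (V : ℕ) : columnGF V = polyaSum V := by
  classical
  have hfac : C (V.factorial : ℚ) ≠ 0 := by
    rw [Ne, map_eq_zero_iff _ (C_injective (R := ℚ))]
    exact_mod_cast V.factorial_ne_zero
  refine mul_left_cancel₀ hfac ?_
  rw [factorial_mul_columnGF, sum_fixGF, polyaSum, finsum_eq_sum_of_fintype, Finset.mul_sum,
    ← Finset.sum_fiberwise (s := Finset.univ) (g := Quotient.mk (simpleGraphSetoid V))]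
  refine Finset.sum_congr rfl fun c _ => ?_
  rw [← sum_card_automorphisms c, Nat.cast_sum, map_sum, Finset.sum_mul]
  refine Finset.sum_congr rfl fun G hG => ?_
  rw [← (Finset.mem_filter.1 hG).2]
  rfl

/-! ### Integer polynomials as coefficient lists -/

/-- The power series `c₀ + c₁ x + c₂ x² + ⋯` with the coefficient list `[c₀, c₁, c₂, …]`. -/
noncomputable def ofInts : List ℤ → PowerSeries ℚ
  | [] => 0
  | a :: p => C (a : ℚ) + X * ofInts p

/-- Sum of polynomials. -/
def addCoeffs : List ℤ → List ℤ → List ℤ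
  | [], q => q
  | p, [] => p
  | a :: p, b :: q => Int.add a b :: addCoeffs p q

/-- Multiplication by `x^n`. -/
def shiftCoeffs (n : ℕ) (p : List ℤ) : List ℤ := List.replicate n 0 ++ p

/-- Multiplication by `1 - x^n`. -/
def mulOneSub (n : ℕ) (p : List ℤ) : List ℤ := addCoeffs p (shiftCoeffs n (p.map Int.neg))

/-- Product of polynomials. -/
def mulCoeffs : List ℤ → List ℤ → List ℤ
  | [], _ => []
  | a :: p, q => addCoeffs (q.map (Int.mul a)) (0 :: mulCoeffs p q)

theorem ofInts_addCoeffs : ∀ p q, ofInts (addCoeffs p q) = ofInts p + ofInts q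
  | [], q => by simp [addCoeffs, ofInts]
  | a :: p, [] => by simp [addCoeffs, ofInts]
  | a :: p, b :: q => by
    have h : ((Int.add a b : ℤ) : ℚ) = a + b := Int.cast_add a b
    rw [addCoeffs, ofInts, ofInts, ofInts, ofInts_addCoeffs p q, h, map_add]
    ring

theorem ofInts_shiftCoeffs (n : ℕ) (p : List ℤ) : ofInts (shiftCoeffs n p) = X ^ n * ofInts p := by
  induction n with
  | zero => simp [shiftCoeffs]
  | succ n ih =>
    have h : shiftCoeffs (n + 1) p = 0 :: shiftCoeffs n p := rfl
    rw [h, ofInts, ih]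
    simp [pow_succ']
    ring

theorem ofInts_map_mul (a : ℤ) (p : List ℤ) :
    ofInts (p.map (Int.mul a)) = C (a : ℚ) * ofInts p := by
  induction p with
  | nil => simp [ofInts]
  | cons b p ih =>
    have h : ((Int.mul a b : ℤ) : ℚ) = a * b := Int.cast_mul a b
    rw [List.map_cons, ofInts, ih, ofInts, h, map_mul]
    ring

theorem ofInts_map_neg (p : List ℤ) : ofInts (p.map Int.neg) = -ofInts p := by
  induction p with
  | nil => simp [ofInts]
  | cons b p ih =>
    have h : ((Int.neg b : ℤ) : ℚ) = -b := Int.cast_neg b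
    rw [List.map_cons, ofInts, ih, ofInts, h, map_neg]
    ring

theorem ofInts_mulOneSub (n : ℕ) (p : List ℤ) :
    ofInts (mulOneSub n p) = (1 - X ^ n) * ofInts p := by
  rw [mulOneSub, ofInts_addCoeffs, ofInts_shiftCoeffs, ofInts_map_neg]
  ring

theorem ofInts_mulCoeffs (p q : List ℤ) : ofInts (mulCoeffs p q) = ofInts p * ofInts q := by
  induction p with
  | nil => simp [mulCoeffs, ofInts]
  | cons a p ih =>
    rw [mulCoeffs, ofInts_addCoeffs, ofInts_map_mul, ofInts, ih, ofInts]
    simp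
    ring

theorem coeff_ofInts (p : List ℤ) (n : ℕ) : coeff n (ofInts p) = (p.getD n 0 : ℤ) := by
  induction p generalizing n with
  | nil => simp [ofInts]
  | cons a p ih =>
    cases n with
    | zero => simp [ofInts]
    | succ n =>
      rw [ofInts, map_add, coeff_C, if_neg (Nat.succ_ne_zero n), coeff_succ_X_mul, ih, zero_add]
      rfl

/-! ### Connecting a labelled set by edges -/

section Orbits

variable {V : ℕ}

/-- The edges in `F`, together with the blocks of equal labels of `f`, connect all vertices:
every function constant on the blocks and along the edges is constant. -/
def Connecting (f : Fin V → ℕ) (F : List (Fin V × Fin V)) : Prop :=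
  ∀ c : Fin V → ℕ, (∀ i j, f i = f j → c i = c j) → (∀ e ∈ F, c e.1 = c e.2) → ∀ i j, c i = c j

theorem connecting_nil {f : Fin V → ℕ} : Connecting f [] ↔ ∀ i j, f i = f j :=
  ⟨fun h => h f (fun _ _ => id) (by simp), fun h _ hc _ i j => hc i j (h i j)⟩

/-- Merging the blocks of the ends of an edge has the same effect as adding the edge. -/
theorem connecting_cons {f g : Fin V → ℕ} {e : Fin V × Fin V} (F : List (Fin V × Fin V))
    (x y : ℕ) (hxy : (f e.1 = x ∧ f e.2 = y) ∨ (f e.1 = y ∧ f e.2 = x))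
    (hg : ∀ i, g i = if f i = x then y else f i) :
    Connecting f (e :: F) ↔ Connecting g F := by
  have he : g e.1 = g e.2 := by
    rw [hg, hg]
    rcases hxy with ⟨h1, h2⟩ | ⟨h1, h2⟩ <;> simp [h1, h2]
  constructor
  · intro h c hc hF
    refine h c (fun i j hij => hc i j ?_) (List.forall_mem_cons.2 ⟨hc _ _ he, hF⟩)
    rw [hg, hg, hij]
  · intro h c hc hF
    obtain ⟨hce, hF⟩ := List.forall_mem_cons.1 hF
    refine h c (fun i j hij => ?_) hF
    rw [hg, hg] at hij
    have key : ∀ i j, f i = x → f j = y → c i = c j := by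
      intro i j hi hj
      rcases hxy with ⟨h1, h2⟩ | ⟨h1, h2⟩
      · exact (hc i e.1 (hi.trans h1.symm)).trans (hce.trans (hc e.2 j (h2.trans hj.symm)))
      · exact (hc i e.2 (hi.trans h2.symm)).trans (hce.symm.trans (hc e.1 j (h1.trans hj.symm)))
    split_ifs at hij with h1 h2 h2
    · exact hc i j (h1.trans h2.symm)
    · exact key i j h1 hij.symm
    · exact (key j i h2 hij).symm
    · exact hc i j hij

theorem Connecting.of_update {f g : Fin V → ℕ} {F : List (Fin V × Fin V)} {v w u : Fin V}
    (hfg : ∀ i, i ≠ v → f i = g i) (hw : w ≠ v) (hfw : f w = f v) (hu : u ≠ v) (hgu : g u = g v)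
    (hF : ∀ e ∈ F, e.1 ≠ v ∧ e.2 ≠ v) (h : Connecting f F) : Connecting g F := by
  intro c hc hcF
  have h1 := h (Function.update c v (c w)) (fun i j hij => ?_) (fun e he => ?_)
  · have h2 : ∀ i, i ≠ v → c i = c w := fun i hi => by
      simpa [hi] using h1 i v
    have h3 : ∀ i, c i = c w := fun i => by
      by_cases hi : i = v
      · rw [hi, ← hc u v hgu, h2 u hu]
      · exact h2 i hi
    exact fun i j => (h3 i).trans (h3 j).symm
  · by_cases hi : i = v <;> by_cases hj : j = v
    · simp [hi, hj]
    · subst hi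
      simp only [Function.update_self, Function.update_of_ne hj]
      exact hc w j (by rw [← hfg w hw, ← hfg j hj, hfw, hij])
    · subst hj
      simp only [Function.update_self, Function.update_of_ne hi]
      exact hc i w (by rw [← hfg w hw, ← hfg i hi, hfw, hij])
    · simp only [Function.update_of_ne hi, Function.update_of_ne hj]
      exact hc i j (by rw [← hfg i hi, ← hfg j hj, hij])
  · rw [Function.update_of_ne (hF e he).1, Function.update_of_ne (hF e he).2]
    exact hcF e he

/-- A vertex `v` that no remaining edge touches may be moved from its block to any other block,
provided that neither of the two blocks consists of `v` alone. -/
theorem connecting_update_iff {f g : Fin V → ℕ} {F : List (Fin V × Fin V)} {v w u : Fin V}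
    (hfg : ∀ i, i ≠ v → f i = g i) (hw : w ≠ v) (hfw : f w = f v) (hu : u ≠ v) (hgu : g u = g v)
    (hF : ∀ e ∈ F, e.1 ≠ v ∧ e.2 ≠ v) : Connecting f F ↔ Connecting g F :=
  ⟨.of_update hfg hw hfw hu hgu hF, .of_update (fun i hi => (hfg i hi).symm) hu hgu hw hfw hF⟩

theorem not_connecting_of_isolated {f : Fin V → ℕ} {F : List (Fin V × Fin V)} {v u : Fin V}
    (hu : u ≠ v) (hf : ∀ w, w ≠ v → f w ≠ f v) (hF : ∀ e ∈ F, e.1 ≠ v ∧ e.2 ≠ v) :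
    ¬ Connecting f F := by
  intro h
  have h1 := h (fun i => if i = v then 1 else 0) (fun i j hij => ?_) (fun e he => ?_) u v
  · simp [hu] at h1
  · by_cases hi : i = v <;> by_cases hj : j = v
    · simp [hi, hj]
    · exact absurd (by rw [← hij, hi]) (hf j hj)
    · exact absurd (by rw [hij, hj]) (hf i hi)
    · simp [hi, hj]
  · simp [hF e he]

/-! ### Summation over unions of orbits -/

open Classical in
/-- The sum, over all subfamilies `S` of the list `os` of edge sets whose union satisfies `Q`, of
`∏_{o ∈ S} x^|o| * ∏_{o ∉ S} (1 - x^|o|)`. -/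
noncomputable def weightSum (Q : List (Fin V × Fin V) → Prop) :
    List (List (Fin V × Fin V)) → PowerSeries ℚ
  | [] => if Q [] then 1 else 0
  | o :: os => (1 - X ^ o.length) * weightSum Q os +
      X ^ o.length * weightSum (fun F => Q (o ++ F)) os

theorem weightSum_congr {Q Q' : List (Fin V × Fin V) → Prop} (os : List (List (Fin V × Fin V)))
    (h : ∀ F, (∀ e ∈ F, e ∈ os.flatten) → (Q F ↔ Q' F)) : weightSum Q os = weightSum Q' os := by
  induction os generalizing Q Q' with
  | nil =>
    have h0 := h [] (by simp)
    by_cases hq : Q []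
    · simp [weightSum, hq, h0.1 hq]
    · simp [weightSum, hq, mt h0.2 hq]
  | cons o os ih =>
    have h1 : weightSum Q os = weightSum Q' os := ih fun F hF => h F fun e he => by
      rw [List.flatten_cons]
      exact List.mem_append_right _ (hF e he)
    have h2 : weightSum (fun F => Q (o ++ F)) os = weightSum (fun F => Q' (o ++ F)) os :=
      ih fun F hF => h _ fun e he => by
        rw [List.flatten_cons, List.mem_append]
        exact (List.mem_append.1 he).imp id (hF e)
    rw [weightSum, weightSum, h1, h2]

theorem weightSum_eq_zero {Q : List (Fin V × Fin V) → Prop} (os : List (List (Fin V × Fin V)))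
    (h : ∀ F, (∀ e ∈ F, e ∈ os.flatten) → ¬ Q F) : weightSum Q os = 0 := by
  rw [weightSum_congr (Q' := fun _ => False) os fun F hF => iff_false_intro (h F hF)]
  clear h
  induction os with
  | nil => simp [weightSum]
  | cons o os ih => simp [weightSum, ih]

/-- The edges in the union of the selected members of the list `os`. -/
def selected (os : List (List (Fin V × Fin V))) (s : Fin os.length → Bool) :
    List (Fin V × Fin V) :=
  (List.ofFn fun i => if s i then os.get i else []).flatten

theorem mem_selected {os : List (List (Fin V × Fin V))} {s : Fin os.length → Bool}
    {e : Fin V × Fin V} : e ∈ selected os s ↔ ∃ i, s i = true ∧ e ∈ os.get i := by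
  simp only [selected, List.mem_flatten, List.mem_ofFn]
  constructor
  · rintro ⟨_, ⟨i, rfl⟩, h⟩
    by_cases hs : s i = true
    · exact ⟨i, hs, by simpa [hs] using h⟩
    · simp [hs] at h
  · rintro ⟨i, hs, h⟩
    exact ⟨_, ⟨i, rfl⟩, by simpa [hs] using h⟩

open Classical in
/-- Clearing the denominators in the sum of `mk_card_weighted`. -/
theorem sum_selected_mul_prod (Q : List (Fin V × Fin V) → Prop)
    (os : List (List (Fin V × Fin V))) (hos : ∀ o ∈ os, o ≠ []) :
    (∑ s : Fin os.length → Bool, if Q (selected os s) then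
        ∏ i, (if s i then X ^ (os.get i).length * (1 - X ^ (os.get i).length)⁻¹ else 1) else 0) *
      (os.map fun o => 1 - X ^ o.length).prod = weightSum Q os := by
  induction os generalizing Q with
  | nil =>
    simp [selected, weightSum]
  | cons o os ih =>
    obtain ⟨ho, hos⟩ := List.forall_mem_cons.1 hos
    have h0 : constantCoeff (1 - X ^ o.length : PowerSeries ℚ) ≠ 0 := by
      simp [ho]
    have hinv : (1 - X ^ o.length : PowerSeries ℚ)⁻¹ * (1 - X ^ o.length) = 1 :=
      PowerSeries.inv_mul_cancel _ h0
    have sel (b : Bool) (s : Fin os.length → Bool) :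
        selected (o :: os) (Fin.cons b s : Fin (os.length + 1) → Bool) =
          if b then o ++ selected os s else selected os s := by
      simp only [selected, List.length_cons, List.ofFn_succ, List.flatten_cons]
      cases b <;> rfl
    rw [weightSum, ← ih Q hos, ← ih (fun F => Q (o ++ F)) hos]
    have split (φ : (Fin (os.length + 1) → Bool) → PowerSeries ℚ) :
        ∑ s, φ s = ∑ s, φ (Fin.cons true s) + ∑ s, φ (Fin.cons false s) := by
      rw [← (Fin.consEquiv fun _ : Fin (os.length + 1) => Bool).sum_comp φ,
        Fintype.sum_prod_type, Fintype.sum_bool]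
      rfl
    have get_succ (i : Fin os.length) : (o :: os).get i.succ = os.get i := rfl
    have get_zero : (o :: os).get (0 : Fin (os.length + 1)) = o := rfl
    have prod_cons (b : Bool) (s : Fin os.length → Bool) :
        (∏ i : Fin (os.length + 1), (if (Fin.cons b s : Fin (os.length + 1) → Bool) i then
          X ^ ((o :: os).get i).length * (1 - X ^ ((o :: os).get i).length)⁻¹ else 1 :
            PowerSeries ℚ)) =
        (if b then X ^ o.length * (1 - X ^ o.length)⁻¹ else 1) *
          ∏ i, (if s i then X ^ (os.get i).length * (1 - X ^ (os.get i).length)⁻¹ else 1) := by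
      rw [Fin.prod_univ_succ]
      simp only [Fin.cons_zero, Fin.cons_succ, get_succ, get_zero]
    let φ (s : Fin (os.length + 1) → Bool) : PowerSeries ℚ := if Q (selected (o :: os) s) then
      ∏ i : Fin (os.length + 1), (if s i then
        X ^ ((o :: os).get i).length * (1 - X ^ ((o :: os).get i).length)⁻¹ else 1) else 0
    change (∑ s, φ s) * _ = _
    rw [split]
    simp only [φ, sel, prod_cons, List.map_cons, List.prod_cons, if_true, if_false, one_mul,
      Bool.false_eq_true, ← mul_ite_zero, ← Finset.mul_sum]
    linear_combination (X ^ o.length * (∑ s : Fin os.length → Bool,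
      if Q (o ++ selected os s) then ∏ i, (if s i then X ^ (os.get i).length *
        (1 - X ^ (os.get i).length)⁻¹ else 1) else 0) *
      (os.map fun o => 1 - X ^ o.length).prod) * hinv

/-! ### Dynamic programming over partitions of the vertices -/

/-- A search tree of pairs of a state, which is a list of vertex labels, and a polynomial. The
states are compared by a numerical key. -/
inductive StateTree
  | leaf
  | node (key : ℕ) (k : List ℕ) (p : List ℤ) (l r : StateTree)

/-- The number with the octal digits `k`. -/
def stateKey (k : List ℕ) : ℕ := k.foldl (fun n d => Nat.add (Nat.mul 8 n) d) 0

namespace StateTree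

/-- Insertion of a state. The polynomials of equal states are added. The states are compared as
well as the keys, so that correctness does not depend on the injectivity of the keys. -/
def insert (n : ℕ) (k : List ℕ) (p : List ℤ) : StateTree → StateTree
  | leaf => node n k p leaf leaf
  | node n' k' p' l r =>
    bif Nat.blt n n' then node n' k' p' (insert n k p l) r
    else bif Nat.beq n n' && k == k' then node n' k' (addCoeffs p p') l r
    else node n' k' p' l (insert n k p r)

/-- Insertion of a state if there is one. -/
def insertOption (p : List ℤ) (t : StateTree) : Option (List ℕ) → StateTree
  | none => t
  | some k => t.insert (stateKey k) k p

/-- The sum of the polynomials of the states with `V` equal labels. -/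
def total (V : ℕ) : StateTree → List ℤ
  | leaf => []
  | node _ k p l r =>
    addCoeffs (bif k == List.replicate V (k.headD 0) then p else [])
      (addCoeffs (l.total V) (r.total V))

/-- The sum of the polynomials in a tree, weighted by a function of the states. -/
noncomputable def value (v : List ℕ → PowerSeries ℚ) : StateTree → PowerSeries ℚ
  | leaf => 0
  | node _ k p l r => ofInts p * v k + l.value v + r.value v

theorem value_insert (v : List ℕ → PowerSeries ℚ) (n : ℕ) (k : List ℕ) (p : List ℤ)
    (t : StateTree) : (t.insert n k p).value v = ofInts p * v k + t.value v := by
  induction t with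
  | leaf => simp [insert, value]
  | node n' k' p' l r hl hr =>
    rw [insert]
    cases Nat.blt n n'
    · cases h : Nat.beq n n' && k == k'
      · simp only [cond_false, value, hr]
        ring
      · have hk : k = k' := by
          rw [Bool.and_eq_true] at h
          exact eq_of_beq h.2
        simp only [cond_false, cond_true, value, ofInts_addCoeffs, hk]
        ring
    · simp only [cond_true, value, hl]
      ring

theorem value_insertOption (v : List ℕ → PowerSeries ℚ) (k : Option (List ℕ)) (p : List ℤ)
    (t : StateTree) :
    (t.insertOption p k).value v = ofInts p * k.elim 0 v + t.value v := by
  cases k with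
  | none => simp [insertOption]
  | some k => rw [insertOption, value_insert, Option.elim]

end StateTree

/-- Merging of the blocks labelled like the vertices `a` and `b`, under the larger label. Since the
vertices are mostly forgotten in increasing order, equal partitions of the others then tend to have
equal labellings. -/
def joinLabels (k : List ℕ) (a b : ℕ) : List ℕ :=
  let x := k.getD a 0
  let y := k.getD b 0
  bif Nat.blt x y then k.map (fun z => bif Nat.beq z x then y else z)
    else k.map (fun z => bif Nat.beq z y then x else z)

/-- Merging of blocks along all edges of `o`. -/
def joinAll (k : List ℕ) (o : List (Fin V × Fin V)) : List ℕ :=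
  o.foldl (fun k e => joinLabels k e.1 e.2) k

/-- Successive transfer of each of the given vertices to the block of the vertex `u`; there is no
result if one of the vertices is alone in its block, which then can never be connected to the
rest. -/
def forget (u : ℕ) : List ℕ → List ℕ → Option (List ℕ)
  | [], k => some k
  | v :: vs, k =>
    let k' := k.set v (k.getD u 0)
    bif k'.any (Nat.beq (k.getD v 0)) then forget u vs k' else none

open StateTree in
/-- The transition of the dynamic programme: for each state, the orbit `o` is skipped, with weight
`1 - x^|o|`, or joined, with weight `x^|o|`; afterwards the vertices `vs` are forgotten. -/
def addOrbit (o : List (Fin V × Fin V)) (vs : List ℕ) : StateTree → StateTree → StateTree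
  | leaf, acc => acc
  | node _ k p l r, acc =>
    addOrbit o vs r (addOrbit o vs l
      ((acc.insertOption (mulOneSub o.length p) (forget (V - 1) vs k)).insertOption
        (shiftCoeffs o.length p) (forget (V - 1) vs (joinAll k o))))

/-- Whether the vertex `v` is an end of an edge in `o`. -/
def touches (v : ℕ) (o : List (Fin V × Fin V)) : Bool :=
  o.any fun e => Nat.beq e.1 v || Nat.beq e.2 v

/-- The vertices that are ends of edges in `o` but not of edges in `os`. The last vertex is left out,
because the forgotten vertices are transferred to its block. -/
def finished (o : List (Fin V × Fin V)) (os : List (List (Fin V × Fin V))) : List ℕ :=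
  (List.range (V - 1)).filter fun v => touches v o && !os.any (touches v)

/-- The dynamic programme for the list of orbits `os`. -/
def addOrbits : List (List (Fin V × Fin V)) → StateTree → StateTree
  | [], t => t
  | o :: os, t => addOrbits os (addOrbit o (finished o os) t .leaf)

/-- The polynomial `∑ ∏_{o ∈ S} x^|o| * ∏_{o ∉ S} (1 - x^|o|)`, the sum being over all subfamilies
`S` of `os` whose union connects all vertices. -/
def numerator (os : List (List (Fin V × Fin V))) : List ℤ :=
  (addOrbits os (.node 0 (List.range V) [1] .leaf .leaf)).total V

/-- The labelling of the vertices given by a state. -/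
def labels (k : List ℕ) (i : Fin V) : ℕ := k.getD i 0

open Classical in
/-- The contribution of a state to the final result when the orbits `os` remain to be
considered. Lists of a length other than `V` do not occur, and are given the value zero in order
that the transition rules hold for all lists. -/
noncomputable def stateValue (os : List (List (Fin V × Fin V))) (k : List ℕ) : PowerSeries ℚ :=
  if k.length = V then weightSum (Connecting (V := V) (labels k)) os else 0

theorem labels_mem {k : List ℕ} (hk : k.length = V) (i : Fin V) : labels k i ∈ k := by
  have hi : (i : ℕ) < k.length := hk ▸ i.2
  rw [labels, List.getD_eq_getElem _ _ hi]
  exact List.getElem_mem hi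

theorem exists_labels_eq {k : List ℕ} (hk : k.length = V) {x : ℕ} (hx : x ∈ k) :
    ∃ i : Fin V, labels k i = x := by
  obtain ⟨i, hi, rfl⟩ := List.getElem_of_mem hx
  exact ⟨⟨i, hk ▸ hi⟩, List.getD_eq_getElem _ _ hi⟩

theorem joinLabels_eq (k : List ℕ) (a b : ℕ) :
    joinLabels k a b = k.map (fun z => bif Nat.beq z (k.getD a 0) then k.getD b 0 else z) ∨
      joinLabels k a b = k.map (fun z => bif Nat.beq z (k.getD b 0) then k.getD a 0 else z) := by
  cases h : Nat.blt (k.getD a 0) (k.getD b 0)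
  · exact .inr (by rw [joinLabels, h, cond_false])
  · exact .inl (by rw [joinLabels, h, cond_true])

theorem length_joinLabels (k : List ℕ) (a b : ℕ) : (joinLabels k a b).length = k.length := by
  rcases joinLabels_eq k a b with h | h <;> rw [h, List.length_map]

theorem length_joinAll (o : List (Fin V × Fin V)) (k : List ℕ) :
    (joinAll k o).length = k.length := by
  induction o generalizing k with
  | nil => rfl
  | cons e o ih => rw [joinAll, List.foldl_cons, ← joinAll, ih, length_joinLabels]

theorem connecting_joinLabels {k : List ℕ} (hk : k.length = V) (e : Fin V × Fin V)
    (F : List (Fin V × Fin V)) :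
    Connecting (labels k) (e :: F) ↔ Connecting (labels (joinLabels k e.1 e.2)) F := by
  have key (x y : ℕ) (i : Fin V) : labels (k.map fun z => bif Nat.beq z x then y else z) i =
      if labels k i = x then y else labels k i := by
    have hi : (i : ℕ) < k.length := hk ▸ i.2
    simp only [labels, List.getD_eq_getElem?_getD, List.getElem?_map, List.getElem?_eq_getElem hi,
      Option.map_some, Option.getD_some, Nat.beq_eq, Bool.cond_eq_ite]
  rcases joinLabels_eq k e.1 e.2 with h | h <;> rw [h]
  · exact connecting_cons F (labels k e.1) (labels k e.2) (.inl ⟨rfl, rfl⟩) (key _ _)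
  · exact connecting_cons F (labels k e.2) (labels k e.1) (.inr ⟨rfl, rfl⟩) (key _ _)

theorem connecting_joinAll {k : List ℕ} (hk : k.length = V) (o F : List (Fin V × Fin V)) :
    Connecting (labels k) (o ++ F) ↔ Connecting (labels (joinAll k o)) F := by
  induction o generalizing k with
  | nil => rfl
  | cons e o ih =>
    rw [List.cons_append, connecting_joinLabels hk, ih (by rw [length_joinLabels, hk])]
    rfl

/-- The value of a state splits according to whether the first orbit is joined. -/
theorem stateValue_cons (o : List (Fin V × Fin V)) (os : List (List (Fin V × Fin V)))
    (k : List ℕ) : stateValue (o :: os) k =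
      (1 - X ^ o.length) * stateValue os k + X ^ o.length * stateValue os (joinAll k o) := by
  unfold stateValue
  rw [length_joinAll]
  by_cases hk : k.length = V
  · simp only [if_pos hk, weightSum]
    rw [weightSum_congr (Q := fun F => Connecting (labels k) (o ++ F)) os
      fun F _ => connecting_joinAll hk o F]
  · simp [if_neg hk]

theorem touches_eq_false {v : Fin V} {o : List (Fin V × Fin V)} (h : touches v o = false) :
    ∀ e ∈ o, e.1 ≠ v ∧ e.2 ≠ v := by
  intro e he
  have := List.any_eq_false.1 h e he
  simpa [Nat.beq_eq, Fin.ext_iff, not_or] using this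

/-- Forgetting vertices that no remaining orbit touches does not change the value. -/
theorem elim_forget (hV : 0 < V) (os : List (List (Fin V × Fin V))) (vs : List ℕ)
    (hvs : ∀ v ∈ vs, v < V - 1 ∧ os.any (touches v) = false) (k : List ℕ) :
    (forget (V - 1) vs k).elim 0 (stateValue os) = stateValue os k := by
  induction vs generalizing k with
  | nil => rfl
  | cons v vs ih =>
    obtain ⟨⟨hv, hos⟩, hvs⟩ := List.forall_mem_cons.1 hvs
    by_cases hk : k.length = V
    swap
    · have hset : (k.set v (k.getD (V - 1) 0)).length ≠ V := by rwa [List.length_set]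
      rw [forget]
      cases k.set v (k.getD (V - 1) 0) |>.any (Nat.beq (k.getD v 0))
      · simp [stateValue, hk]
      · rw [cond_true, ih hvs]
        simp [stateValue, hk]
    have hvV : v < V := by omega
    have hF : ∀ F : List (Fin V × Fin V), (∀ e ∈ F, e ∈ os.flatten) →
        ∀ e ∈ F, e.1 ≠ ⟨v, hvV⟩ ∧ e.2 ≠ ⟨v, hvV⟩ := by
      intro F hF e he
      obtain ⟨o, ho, heo⟩ := List.mem_flatten.1 (hF e he)
      exact touches_eq_false (by simpa using List.any_eq_false.1 hos o ho) e heo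
    let u : Fin V := ⟨V - 1, by omega⟩
    have hu : u ≠ ⟨v, hvV⟩ := fun h => by
      have := congrArg Fin.val h
      simp only [u] at this
      omega
    have hlab (i : Fin V) : labels (k.set v (k.getD (V - 1) 0)) i =
        if i = ⟨v, hvV⟩ then labels k u else labels k i := by
      simp only [labels, List.getD_eq_getElem?_getD, List.getElem?_set, Fin.ext_iff, u]
      by_cases h : (i : ℕ) = v
      · simp [h, hk, hvV]
      · simp [h, Ne.symm h]
    rw [forget]
    cases hany : k.set v (k.getD (V - 1) 0) |>.any (Nat.beq (k.getD v 0))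
    · rw [cond_false, Option.elim, stateValue, if_pos hk, weightSum_eq_zero]
      intro F hFo
      refine not_connecting_of_isolated hu (fun w hw hkw => ?_) (hF F hFo)
      have h1 := List.any_eq_false.1 hany _ (labels_mem (by rw [List.length_set, hk]) w)
      rw [hlab, if_neg hw, hkw] at h1
      exact h1 (Nat.beq_refl _)
    · rw [cond_true, ih hvs, stateValue, stateValue, List.length_set, if_pos hk, if_pos hk]
      refine weightSum_congr os fun F hFo => ?_
      obtain ⟨x, hx, hvx⟩ := List.any_eq_true.1 hany
      obtain ⟨j, hj⟩ := exists_labels_eq (by rw [List.length_set, hk]) hx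
      replace hvx : labels k (⟨v, hvV⟩ : Fin V) = x := Nat.eq_of_beq_eq_true hvx
      rw [← hvx, hlab] at hj
      obtain ⟨w, hw, hkw⟩ : ∃ w : Fin V, w ≠ ⟨v, hvV⟩ ∧ labels k w = labels k ⟨v, hvV⟩ := by
        by_cases h : j = ⟨v, hvV⟩
        · exact ⟨u, hu, by rwa [if_pos h] at hj⟩
        · exact ⟨j, h, by rwa [if_neg h] at hj⟩
      refine (connecting_update_iff (fun i hi => ?_) hw hkw hu ?_ (hF F hFo)).symm
      · rw [hlab, if_neg hi]
      · rw [hlab, hlab, if_neg hu, if_pos rfl]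

theorem value_addOrbit (hV : 0 < V) (o : List (Fin V × Fin V)) (os : List (List (Fin V × Fin V)))
    (t acc : StateTree) :
    (addOrbit o (finished o os) t acc).value (stateValue os) =
      acc.value (stateValue os) + t.value (stateValue (o :: os)) := by
  have hvs : ∀ v ∈ finished o os, v < V - 1 ∧ os.any (touches v) = false := by
    intro v hv
    obtain ⟨h1, h2⟩ := List.mem_filter.1 hv
    rw [Bool.and_eq_true, Bool.not_eq_true'] at h2
    exact ⟨List.mem_range.1 h1, h2.2⟩
  induction t generalizing acc with
  | leaf => simp [addOrbit, StateTree.value]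
  | node n k p l r hl hr =>
    rw [addOrbit, hr, hl, StateTree.value_insertOption, StateTree.value_insertOption,
      elim_forget hV os _ hvs, elim_forget hV os _ hvs, ofInts_mulOneSub, ofInts_shiftCoeffs,
      StateTree.value, stateValue_cons]
    ring

theorem ofInts_total (t : StateTree) :
    ofInts (t.total V) = t.value (stateValue (V := V) []) := by
  induction t with
  | leaf => rfl
  | node n k p l r hl hr =>
    have h : (k == List.replicate V (k.headD 0)) = true ↔
        k.length = V ∧ Connecting (V := V) (labels k) [] := by
      rw [beq_iff_eq, connecting_nil, List.eq_replicate_iff]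
      refine and_congr_right fun hk => ⟨fun h i j => ?_, fun h x hx => ?_⟩
      · rw [h _ (labels_mem hk i), h _ (labels_mem hk j)]
      · obtain ⟨i, rfl⟩ := exists_labels_eq hk hx
        have hne : k ≠ [] := List.ne_nil_of_mem hx
        obtain ⟨j, hj⟩ := exists_labels_eq hk (List.head_mem hne)
        rw [h i j, hj, List.head_eq_getElem, List.headD_eq_head?_getD, List.head?_eq_some_head hne]
        simp [List.head_eq_getElem]
    rw [StateTree.total, StateTree.value, ofInts_addCoeffs, ofInts_addCoeffs, hl, hr, ← add_assoc]
    congr 2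
    by_cases hk : (k == List.replicate V (k.headD 0)) = true
    · obtain ⟨h1, h2⟩ := h.1 hk
      rw [hk, cond_true, stateValue, if_pos h1, weightSum, if_pos h2, mul_one]
    · have h1 : stateValue (V := V) [] k = 0 := by
        rw [stateValue]
        split_ifs with h1
        · rw [weightSum, if_neg fun h2 => hk (h.2 ⟨h1, h2⟩)]
        · rfl
      rw [Bool.eq_false_iff.2 hk, cond_false, h1, mul_zero, ofInts]

theorem value_addOrbits (hV : 0 < V) (os : List (List (Fin V × Fin V))) (t : StateTree) :
    (addOrbits os t).value (stateValue (V := V) []) = t.value (stateValue os) := by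
  induction os generalizing t with
  | nil => rfl
  | cons o os ih => rw [addOrbits, ih, value_addOrbit hV, StateTree.value, zero_add]

/-- Correctness of the dynamic programme. -/
theorem ofInts_numerator (hV : 0 < V) (os : List (List (Fin V × Fin V))) :
    ofInts (numerator os) = weightSum (Connecting fun i : Fin V => (i : ℕ)) os := by
  have h : (labels (List.range V) : Fin V → ℕ) = fun i : Fin V => (i : ℕ) := by
    funext i
    simp [labels, List.getD_eq_getElem?_getD]
  rw [numerator, ofInts_total, value_addOrbits hV, StateTree.value, stateValue,
    if_pos List.length_range, h]
  simp [StateTree.value, ofInts]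

/-! ### Invariant multigraphs and orbits of pairs of vertices -/

/-- The two elements of an unordered pair in increasing order. -/
def sortedPair (e : Sym2 (Fin V)) : Fin V × Fin V := (e.inf, e.sup)

theorem sortedPair_mk (a b : Fin V) :
    sortedPair s(a, b) = if a < b then (a, b) else (b, a) := by
  rw [sortedPair, Sym2.inf_mk, Sym2.sup_mk]
  split_ifs with h
  · rw [inf_eq_left.2 h.le, sup_eq_right.2 h.le]
  · rw [inf_eq_right.2 (not_lt.1 h), sup_eq_left.2 (not_lt.1 h)]

theorem mk_sortedPair (e : Sym2 (Fin V)) : s((sortedPair e).1, (sortedPair e).2) = e := by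
  induction e using Sym2.ind with
  | _ a b =>
    rw [sortedPair_mk]
    split_ifs
    · rfl
    · exact Sym2.eq_swap

theorem sortedPair_injective : Function.Injective (sortedPair (V := V)) := fun e e' h => by
  rw [← mk_sortedPair e, h, mk_sortedPair]

/-- The action of a permutation of the vertices on increasing pairs of vertices. -/
def act (σ : Equiv.Perm (Fin V)) (e : Fin V × Fin V) : Fin V × Fin V :=
  if σ e.1 < σ e.2 then (σ e.1, σ e.2) else (σ e.2, σ e.1)

theorem act_eq (σ : Equiv.Perm (Fin V)) (e : Fin V × Fin V) :
    act σ e = sortedPair (s(e.1, e.2).map σ) := by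
  rw [Sym2.map_mk, sortedPair_mk, act]

theorem act_sortedPair (σ : Equiv.Perm (Fin V)) (e : Sym2 (Fin V)) :
    act σ (sortedPair e) = sortedPair (e.map σ) := by
  rw [act_eq, mk_sortedPair]

/-- The list `os` consists of the orbits of `σ` on the increasing pairs of vertices, each listed
in cyclic order. -/
def IsOrbitList (σ : Equiv.Perm (Fin V)) (os : List (List (Fin V × Fin V))) : Prop :=
  os.flatten.Nodup ∧ (∀ a b, (a, b) ∈ os.flatten ↔ a < b) ∧
    ∀ o ∈ os, o ≠ [] ∧ o.map (act σ) = o.rotate 1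

instance (σ : Equiv.Perm (Fin V)) (os : List (List (Fin V × Fin V))) :
    Decidable (IsOrbitList σ os) :=
  inferInstanceAs (Decidable (_ ∧ _ ∧ _))

namespace IsOrbitList

variable {σ : Equiv.Perm (Fin V)} {os : List (List (Fin V × Fin V))}

theorem lt_of_mem (h : IsOrbitList σ os) {i : Fin os.length} {e : Fin V × Fin V}
    (he : e ∈ os.get i) : e.1 < e.2 :=
  (h.2.1 _ _).1 (List.mem_flatten.2 ⟨_, os.get_mem i, he⟩)

theorem sortedPair_eq (h : IsOrbitList σ os) {i : Fin os.length} {e : Fin V × Fin V}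
    (he : e ∈ os.get i) : sortedPair s(e.1, e.2) = e := by
  rw [sortedPair_mk, if_pos (h.lt_of_mem he)]

theorem exists_mem (h : IsOrbitList σ os) {e : Sym2 (Fin V)} (he : ¬ e.IsDiag) :
    ∃ i, sortedPair e ∈ os.get i := by
  have hlt : (sortedPair e).1 < (sortedPair e).2 := by
    induction e using Sym2.ind with
    | _ a b =>
      rw [Sym2.mk_isDiag_iff] at he
      rw [sortedPair_mk]
      split_ifs with hab
      · exact hab
      · exact lt_of_le_of_ne (not_lt.1 hab) (Ne.symm he)
  obtain ⟨o, ho, heo⟩ := List.mem_flatten.1 ((h.2.1 _ _).2 hlt)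
  obtain ⟨i, rfl⟩ := List.get_of_mem ho
  exact ⟨i, heo⟩

theorem eq_of_mem (h : IsOrbitList σ os) {i j : Fin os.length} {e : Fin V × Fin V}
    (hi : e ∈ os.get i) (hj : e ∈ os.get j) : i = j := by
  have hd := List.pairwise_iff_get.1 (List.nodup_flatten.1 h.1).2
  rcases lt_trichotomy i j with hij | hij | hij
  · exact absurd hj (hd i j hij hi)
  · exact hij
  · exact absurd hi (hd j i hij hj)

theorem map_mem_iff (h : IsOrbitList σ os) (i : Fin os.length) (e : Sym2 (Fin V)) :
    sortedPair (e.map σ) ∈ os.get i ↔ sortedPair e ∈ os.get i := by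
  have hi := (h.2.2 _ (os.get_mem i)).2
  rw [← List.mem_rotate (n := 1), ← hi, List.mem_map]
  constructor
  · rintro ⟨e', he', h1⟩
    rw [act_eq] at h1
    have h2 := Sym2.map.injective σ.injective (sortedPair_injective h1)
    rwa [← h2, h.sortedPair_eq he']
  · exact fun he => ⟨_, he, act_sortedPair σ e⟩

/-- A function that is invariant under the permutation is constant on each orbit. -/
theorem eq_of_invariant (h : IsOrbitList σ os) {f : Sym2 (Fin V) → ℕ}
    (hf : ∀ e, f (e.map σ) = f e) {i : Fin os.length} {e e' : Fin V × Fin V}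
    (he : e ∈ os.get i) (he' : e' ∈ os.get i) : f s(e.1, e.2) = f s(e'.1, e'.2) := by
  have hi := congrArg (List.map fun p => f s(p.1, p.2)) (h.2.2 _ (os.get_mem i)).2
  have hact : (fun p => f s(p.1, p.2)) ∘ act σ = fun p : Fin V × Fin V => f s(p.1, p.2) := by
    funext p
    rw [Function.comp_apply, act_eq, mk_sortedPair, hf]
  -- the list of values along the orbit equals its own rotation by one place
  rw [List.map_map, hact, List.map_rotate, eq_comm,
    List.rotate_one_eq_self_iff_eq_replicate] at hi
  obtain ⟨a, ha⟩ := hi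
  have h1 {p : Fin V × Fin V} (hp : p ∈ os.get i) : f s(p.1, p.2) = a :=
    List.eq_of_mem_replicate
      (ha ▸ List.mem_map_of_mem (f := fun p : Fin V × Fin V => f s(p.1, p.2)) hp)
  rw [h1 he, h1 he']

/-- The multigraph in which the pairs in the `i`-th orbit have multiplicity `g i`. -/
def toMultigraph (h : IsOrbitList σ os) (g : Fin os.length → ℕ) : LooplessMultigraph (Fin V) where
  mult e := ∑ i, if sortedPair e ∈ os.get i then g i else 0
  loopless a := Finset.sum_eq_zero fun i _ => if_neg fun hi => by
    have := h.lt_of_mem hi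
    rw [sortedPair_mk, if_neg (lt_irrefl a)] at this
    exact lt_irrefl a this

theorem toMultigraph_mult (h : IsOrbitList σ os) (g : Fin os.length → ℕ) {e : Sym2 (Fin V)}
    {i : Fin os.length} (hi : sortedPair e ∈ os.get i) : (h.toMultigraph g).mult e = g i := by
  refine (Finset.sum_eq_single i (fun j _ hj => if_neg fun h1 => ?_)
    (fun h1 => absurd (Finset.mem_univ i) h1)).trans (if_pos hi)
  exact hj (h.eq_of_mem h1 hi)

theorem smul_toMultigraph (h : IsOrbitList σ os) (g : Fin os.length → ℕ) :
    σ • h.toMultigraph g = h.toMultigraph g := by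
  rw [smul_eq_iff]
  intro e
  simp only [toMultigraph, h.map_mem_iff]

theorem toMultigraph_injective (h : IsOrbitList σ os) : Function.Injective h.toMultigraph := by
  intro g g' hg
  funext i
  obtain ⟨e, he⟩ := List.exists_mem_of_ne_nil _ (h.2.2 _ (os.get_mem i)).1
  rw [← h.sortedPair_eq he] at he
  rw [← h.toMultigraph_mult g he, hg, h.toMultigraph_mult g' he]

theorem exists_toMultigraph_eq (h : IsOrbitList σ os) {M : LooplessMultigraph (Fin V)}
    (hM : σ • M = M) : ∃ g, h.toMultigraph g = M := by
  have ho (i : Fin os.length) := (h.2.2 _ (os.get_mem i)).1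
  refine ⟨fun i => M.mult s(((os.get i).head (ho i)).1, ((os.get i).head (ho i)).2), ?_⟩
  ext e
  by_cases he : e.IsDiag
  · induction e using Sym2.ind with
    | _ a b =>
      rw [Sym2.mk_isDiag_iff] at he
      rw [he, M.loopless, LooplessMultigraph.loopless]
  · obtain ⟨i, hi⟩ := h.exists_mem he
    rw [h.toMultigraph_mult _ hi, h.eq_of_invariant (smul_eq_iff.1 hM) (List.head_mem (ho i)) hi,
      mk_sortedPair]

theorem numEdges_toMultigraph (h : IsOrbitList σ os) (g : Fin os.length → ℕ) :
    (h.toMultigraph g).numEdges = ∑ i, (os.get i).length * g i := by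
  simp only [numEdges, toMultigraph]
  rw [Finset.sum_comm]
  refine Finset.sum_congr rfl fun i _ => ?_
  rw [← Finset.sum_filter, Finset.sum_const, smul_eq_mul,
    ← List.toFinset_card_of_nodup ((List.nodup_flatten.1 h.1).1 _ (os.get_mem i))]
  congr 1
  refine Finset.card_bij (fun e _ => sortedPair e) (fun e he => ?_)
    (fun _ _ _ _ h => sortedPair_injective h) fun e he => ?_
  · simpa using he
  · rw [List.mem_toFinset] at he
    refine ⟨s(e.1, e.2), ?_, h.sortedPair_eq he⟩
    rw [Finset.mem_filter, h.sortedPair_eq he]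
    exact ⟨Finset.mem_univ _, he⟩

end IsOrbitList

theorem connected_iff_const (hV : 0 < V) (G : SimpleGraph (Fin V)) :
    G.Connected ↔ ∀ c : Fin V → ℕ, (∀ a b, G.Adj a b → c a = c b) → ∀ i j, c i = c j := by
  classical
  constructor
  · intro h c hc i j
    obtain ⟨w⟩ := h.preconnected i j
    induction w with
    | nil => rfl
    | cons hab _ ih => exact (hc _ _ hab).trans ih
  · intro h
    have : Nonempty (Fin V) := ⟨⟨0, hV⟩⟩
    refine SimpleGraph.Connected.mk fun i j => ?_
    have h1 := h (fun k => if G.Reachable i k then 0 else 1) (fun a b hab => ?_) i j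
    · by_contra hij
      simp [hij] at h1
    · have : G.Reachable i a ↔ G.Reachable i b :=
        ⟨fun hr => hr.trans hab.reachable, fun hr => hr.trans hab.symm.reachable⟩
      simp only [this]

theorem IsOrbitList.connected_toMultigraph {σ : Equiv.Perm (Fin V)}
    {os : List (List (Fin V × Fin V))} (h : IsOrbitList σ os) (hV : 0 < V)
    (g : Fin os.length → ℕ) : (h.toMultigraph g).underlying.Connected ↔
      Connecting (fun i : Fin V => (i : ℕ)) (selected os fun i => decide (g i ≠ 0)) := by
  rw [connected_iff_const hV]
  refine forall_congr' fun c => ?_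
  have h1 : ∀ i j : Fin V, (i : ℕ) = j → c i = c j := fun i j hij => by rw [Fin.ext hij]
  rw [imp_iff_right h1]
  refine imp_congr_left ⟨fun hc e he => ?_, fun hc a b hab => ?_⟩
  · obtain ⟨i, hi, hei⟩ := mem_selected.1 he
    refine hc _ _ ?_
    rw [← h.sortedPair_eq hei] at hei
    change (h.toMultigraph g).mult s(e.1, e.2) ≠ 0
    rw [h.toMultigraph_mult g hei]
    exact of_decide_eq_true hi
  · obtain ⟨i, hi⟩ := h.exists_mem (e := s(a, b)) (by simpa using hab.ne)
    have hg : g i ≠ 0 := by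
      rw [← h.toMultigraph_mult g hi]
      exact hab
    have h2 := hc _ (mem_selected.2 ⟨i, decide_eq_true hg, hi⟩)
    rw [sortedPair_mk] at h2
    split_ifs at h2
    · exact h2
    · exact h2.symm

/-- The multigraphs invariant under `σ` are the assignments of multiplicities to the orbits. -/
theorem IsOrbitList.fixCount_eq {σ : Equiv.Perm (Fin V)} {os : List (List (Fin V × Fin V))}
    (h : IsOrbitList σ os) (hV : 0 < V) (E : ℕ) :
    fixCount σ E = Nat.card {g : Fin os.length → ℕ //
      Connecting (fun i : Fin V => (i : ℕ)) (selected os fun i => decide (g i ≠ 0)) ∧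
        ∑ i, (os.get i).length * g i = E} := by
  refine (Nat.card_congr (Equiv.ofBijective (fun g => ⟨h.toMultigraph g.1,
    ⟨(h.connected_toMultigraph hV _).2 g.2.1, (h.numEdges_toMultigraph _).trans g.2.2⟩,
    h.smul_toMultigraph _⟩) ⟨fun g g' hg => ?_, ?_⟩)).symm
  · exact Subtype.ext (h.toMultigraph_injective (Subtype.mk.inj hg))
  · rintro ⟨M, ⟨hc, hE⟩, hM⟩
    obtain ⟨g, rfl⟩ := h.exists_toMultigraph_eq hM
    exact ⟨⟨g, (h.connected_toMultigraph hV g).1 hc, (h.numEdges_toMultigraph g).symm.trans hE⟩,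
      rfl⟩

/-- The generating function of the invariant connected multigraphs, as a quotient of
polynomials. -/
theorem IsOrbitList.fixGF_mul_prod {σ : Equiv.Perm (Fin V)} {os : List (List (Fin V × Fin V))}
    (h : IsOrbitList σ os) (hV : 0 < V) :
    fixGF σ * (os.map fun o => 1 - X ^ o.length).prod = ofInts (numerator os) := by
  classical
  rw [ofInts_numerator hV, ← sum_selected_mul_prod _ os fun o ho => (h.2.2 o ho).1, fixGF]
  congr 1
  simp only [h.fixCount_eq hV]
  exact mk_card_weighted (fun i => (os.get i).length)
    (fun i => List.length_pos_of_ne_nil (h.2.2 _ (os.get_mem i)).1)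
    (fun s => Connecting (fun i : Fin V => (i : ℕ)) (selected os s))

/-! ### Reduction to representatives of the conjugacy classes -/

theorem fixGF_eq_of_cycleType_eq {V : ℕ} {σ τ : Equiv.Perm (Fin V)}
    (h : σ.cycleType = τ.cycleType) : fixGF σ = fixGF τ := by
  obtain ⟨π, rfl⟩ := isConj_iff.1 (Equiv.Perm.isConj_of_cycleType_eq h)
  unfold fixGF
  congr 1
  funext E
  rw [← card_fixedBy, ← card_fixedBy, ← MulAction.smul_fixedBy]
  exact congrArg _ (Nat.card_image_of_injective (MulAction.injective π) _).symm

/-- The successive images under `σ` of the pair `e`, up to the pair `e₀`, at most `n` in number. -/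
def orbitFrom (σ : Equiv.Perm (Fin V)) (e₀ : Fin V × Fin V) :
    ℕ → Fin V × Fin V → List (Fin V × Fin V)
  | 0, _ => []
  | n + 1, e => e :: (if act σ e = e₀ then [] else orbitFrom σ e₀ n (act σ e))

/-- The increasing pairs of vertices, in lexicographic order. -/
def pairs (V : ℕ) : List (Fin V × Fin V) :=
  (List.finRange V).flatMap fun a => ((List.finRange V).filter (a < ·)).map fun b => (a, b)

/-- The orbits of `σ` on the increasing pairs of vertices. -/
def orbits (σ : Equiv.Perm (Fin V)) : List (List (Fin V × Fin V)) :=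
  (pairs V).foldl (fun os e => if e ∈ os.flatten then os else os ++ [orbitFrom σ e (V * V) e]) []

/-- The partition of an initial segment of the vertices, starting at the vertex `n`, into intervals
of the given lengths. -/
def intervals (V : ℕ) [NeZero V] : ℕ → List ℕ → List (List (Fin V))
  | _, [] => []
  | n, l :: ls => (List.range' n l).map (Fin.ofNat V) :: intervals V (n + l) ls

/-- The permutation whose cycles are the intervals of the given lengths. -/
def rep (V : ℕ) [NeZero V] (ls : List ℕ) : Equiv.Perm (Fin V) :=
  ((intervals V 0 ls).map List.formPerm).prod

/-- The lengths of the intervals are as given, they are at least two, and the intervals are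
disjoint. -/
def IsType (V : ℕ) [NeZero V] (ls : List ℕ) : Prop :=
  (intervals V 0 ls).map List.length = ls ∧ (∀ l ∈ ls, 2 ≤ l) ∧
    (intervals V 0 ls).flatten.Nodup

instance (V : ℕ) [NeZero V] (ls : List ℕ) : Decidable (IsType V ls) :=
  inferInstanceAs (Decidable (_ ∧ _ ∧ _))

theorem IsType.cycleType_rep [NeZero V] {ls : List ℕ} (h : IsType V ls) :
    (rep V ls).cycleType = ls := by
  obtain ⟨h1, h2, h3⟩ := h
  obtain ⟨hn, hd⟩ := List.nodup_flatten.1 h3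
  have hl : ∀ b ∈ intervals V 0 ls, 2 ≤ b.length := fun b hb =>
    h2 _ (h1 ▸ List.mem_map_of_mem hb)
  rw [rep, Equiv.Perm.cycleType_eq _ rfl, List.map_map]
  · conv_rhs => rw [← h1]
    refine congrArg _ (List.map_congr_left fun b hb => ?_)
    have h4 : ∀ x, b ≠ [x] := fun x hx => by
      have := hl b hb
      rw [hx, List.length_singleton] at this
      omega
    rw [Function.comp_apply, Function.comp_apply, List.support_formPerm_of_nodup _ (hn b hb) h4,
      List.toFinset_card_of_nodup (hn b hb)]
  · intro σ hσ
    obtain ⟨b, hb, rfl⟩ := List.mem_map.1 hσ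
    exact List.isCycle_formPerm (hn b hb) (hl b hb)
  · rw [List.pairwise_map]
    refine hd.imp_of_mem fun {b b'} hb hb' hbb => ?_
    exact (List.formPerm_disjoint_iff (hn b hb) (hn b' hb') (hl b hb) (hl b' hb')).2 hbb

/-- The number of permutations of `V` points whose cycles of length at least two have the lengths
`ls`. -/
def classSize (V : ℕ) (ls : List ℕ) : ℕ :=
  V.factorial / ((V - ls.sum).factorial * ls.prod *
    (ls.dedup.map fun n => (ls.count n).factorial).prod)

theorem card_cycleType_eq {ls : List ℕ} (h : ls.sum ≤ V ∧ ∀ l ∈ ls, 2 ≤ l) :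
    (Finset.univ.filter fun σ : Equiv.Perm (Fin V) => σ.cycleType = ls).card =
      classSize V ls := by
  have := Equiv.Perm.card_of_cycleType (Fin V) (ls : Multiset ℕ)
  rw [if_pos (by simpa using h)] at this
  rw [this, classSize, Fintype.card_fin]
  congr 2
  rw [Finset.prod_eq_multiset_prod]
  simp

end Orbits

/-- A list of cycle types is complete if the types are different and the sizes of their classes add
up to the order of the symmetric group. -/
def IsComplete (V : ℕ) [NeZero V] (types : List (List ℕ)) : Prop :=
  (types.Pairwise fun ls ls' => ¬ ls.Perm ls') ∧ (∀ ls ∈ types, IsType V ls ∧ ls.sum ≤ V) ∧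
    (types.map (classSize V)).sum = V.factorial

instance (V : ℕ) [NeZero V] (types : List (List ℕ)) : Decidable (IsComplete V types) :=
  inferInstanceAs (Decidable (_ ∧ _ ∧ _))

theorem IsComplete.sum_fixGF {V : ℕ} [NeZero V] {types : List (List ℕ)}
    (h : IsComplete V types) : ∑ σ : Equiv.Perm (Fin V), fixGF σ =
      (types.map fun ls => C (classSize V ls : ℚ) * fixGF (rep V ls)).sum := by
  classical
  obtain ⟨h1, h2, h3⟩ := h
  have hnd : types.Nodup := h1.imp fun {ls ls'} h (hls : ls = ls') => h (by rw [hls])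
  let cls (ls : List ℕ) := Finset.univ.filter fun σ : Equiv.Perm (Fin V) => σ.cycleType = ls
  have hcard : ∀ ls ∈ types, (cls ls).card = classSize V ls := fun ls hls =>
    card_cycleType_eq ⟨(h2 ls hls).2, (h2 ls hls).1.2.1⟩
  have hdis : ((types.toFinset : Finset (List ℕ)) : Set (List ℕ)).PairwiseDisjoint cls := by
    have : Std.Symm fun ls ls' : List ℕ => ¬ ls.Perm ls' := ⟨fun _ _ h hp => h hp.symm⟩
    intro ls hls ls' hls' hne
    refine Finset.disjoint_left.2 fun σ hσ hσ' => ?_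
    have hp : ls.Perm ls' := Multiset.coe_eq_coe.1
      ((Finset.mem_filter.1 hσ).2.symm.trans (Finset.mem_filter.1 hσ').2)
    exact h1.forall (List.mem_toFinset.1 hls) (List.mem_toFinset.1 hls') hne hp
  -- the classes are disjoint and have `V!` elements in total, so that there are no others
  have huniv : types.toFinset.biUnion cls = Finset.univ := by
    refine Finset.eq_univ_of_card _ ?_
    rw [Finset.card_biUnion hdis, Fintype.card_perm, Fintype.card_fin, ← h3,
      List.sum_toFinset _ hnd]
    exact congrArg _ (List.map_congr_left hcard)
  rw [← huniv, Finset.sum_biUnion hdis, List.sum_toFinset _ hnd]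
  refine congrArg _ (List.map_congr_left fun ls hls => ?_)
  have h4 : ∀ σ ∈ cls ls, fixGF σ = fixGF (rep V ls) := fun σ hσ =>
    fixGF_eq_of_cycleType_eq ((Finset.mem_filter.1 hσ).2.trans (h2 ls hls).1.cycleType_rep.symm)
  rw [Finset.sum_congr rfl h4, Finset.sum_const, hcard ls hls, nsmul_eq_mul, map_natCast]

/-! ### Verification of the closed forms -/

/-- The quotient by `1 - x^n` modulo `x^m`, where `m` is the length of the list; `acc` holds the
coefficients already computed, the last one first. -/
def divOneSub (n : ℕ) (acc : List ℤ) : List ℤ → List ℤ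
  | [] => acc.reverse
  | a :: p => divOneSub n (Int.add a (acc.getD (n - 1) 0) :: acc) p

/-- Equality of polynomials, whatever the numbers of trailing zeros in the lists. -/
def agree (p q : List ℤ) : Bool := (addCoeffs p (q.map Int.neg)).all (· == 0)

theorem ofInts_eq_zero {p : List ℤ} (h : p.all (· == 0) = true) : ofInts p = 0 := by
  induction p with
  | nil => rfl
  | cons a p ih =>
    rw [List.all_cons, Bool.and_eq_true, beq_iff_eq] at h
    simp [ofInts, h.1, ih h.2]

theorem ofInts_eq_of_agree {p q : List ℤ} (h : agree p q = true) : ofInts p = ofInts q := by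
  have := ofInts_eq_zero h
  rwa [ofInts_addCoeffs, ofInts_map_neg, add_neg_eq_zero] at this

/-- The product of the powers `p ^ n` of polynomials in a list of pairs `(p, n)`. -/
def prodPow (l : List (List ℤ × ℕ)) : List ℤ :=
  l.foldr (fun f q => (mulCoeffs f.1)^[f.2] q) [1]

theorem ofInts_prodPow (l : List (List ℤ × ℕ)) :
    ofInts (prodPow l) = (l.map fun f => ofInts f.1 ^ f.2).prod := by
  induction l with
  | nil => simp [prodPow, ofInts]
  | cons f l ih =>
    have h (n : ℕ) (q : List ℤ) : ofInts ((mulCoeffs f.1)^[n] q) = ofInts f.1 ^ n * ofInts q := by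
      induction n with
      | zero => simp
      | succ n ih => rw [Function.iterate_succ_apply', ofInts_mulCoeffs, ih, pow_succ']; ring
    rw [prodPow, List.foldr_cons, ← prodPow, h, ih, List.map_cons, List.prod_cons]

/-- The quotient of `q` by the product of the polynomials `1 - x^|o|`, if it is a polynomial. The
division is verified by multiplication with `mulAll`. -/
def cofactor {V : ℕ} (q : List ℤ) (os : List (List (Fin V × Fin V))) : List ℤ :=
  os.foldl (fun p o => divOneSub o.length [] p) q

/-- The product of `p` with the polynomials `1 - x^|o|`. -/
def mulAll {V : ℕ} (p : List ℤ) (os : List (List (Fin V × Fin V))) : List ℤ :=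
  os.foldl (fun p o => mulOneSub o.length p) p

theorem ofInts_mulAll {V : ℕ} (os : List (List (Fin V × Fin V))) (p : List ℤ) :
    ofInts (mulAll p os) = (os.map fun o => 1 - X ^ o.length).prod * ofInts p := by
  induction os generalizing p with
  | nil => simp [mulAll]
  | cons o os ih =>
    rw [mulAll, List.foldl_cons, ← mulAll, ih, ofInts_mulOneSub, List.map_cons, List.prod_cons]
    ring

/-- The sum over the cycle types of the numerators for the common denominator `q`, weighted by the
sizes of the classes. -/
def totalNumerator (V : ℕ) [NeZero V] (q : List ℤ) : List (List ℕ) → List ℤ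
  | [] => []
  | ls :: types =>
    let os := orbits (rep V ls)
    addCoeffs
      ((mulCoeffs (numerator os) (cofactor q os)).map (Int.mul (Int.ofNat (classSize V ls))))
      (totalNumerator V q types)

/-- The conditions under which the column generating function is `num / q`. -/
def IsCertificate (V : ℕ) [NeZero V] (types : List (List ℕ)) (q num : List ℤ) : Prop :=
  IsComplete V types ∧
    (∀ ls ∈ types, IsOrbitList (rep V ls) (orbits (rep V ls))) ∧
    (∀ ls ∈ types,
      agree (mulAll (cofactor q (orbits (rep V ls))) (orbits (rep V ls))) q = true) ∧
    agree (totalNumerator V q types) (num.map (Int.mul (Int.ofNat V.factorial))) = true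

instance (V : ℕ) [NeZero V] (types : List (List ℕ)) (q num : List ℤ) :
    Decidable (IsCertificate V types q num) :=
  inferInstanceAs (Decidable (_ ∧ _ ∧ _ ∧ _))

theorem IsCertificate.columnGF_mul {V : ℕ} [NeZero V] {types : List (List ℕ)} {q num : List ℤ}
    (h : IsCertificate V types q num) : columnGF V * ofInts q = ofInts num := by
  obtain ⟨h1, h2, h3, h4⟩ := h
  have hV : 0 < V := Nat.pos_of_ne_zero (NeZero.ne V)
  have hsum : ∀ types' : List (List ℕ), (∀ ls ∈ types', ls ∈ types) →
      (types'.map fun ls => C (classSize V ls : ℚ) * fixGF (rep V ls)).sum * ofInts q =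
        ofInts (totalNumerator V q types') := by
    intro types' ht
    induction types' with
    | nil => simp [totalNumerator, ofInts]
    | cons ls types' ih =>
      obtain ⟨hls, ht⟩ := List.forall_mem_cons.1 ht
      have h5 : fixGF (rep V ls) * ofInts q = ofInts (numerator (orbits (rep V ls))) *
          ofInts (cofactor q (orbits (rep V ls))) := by
        rw [← (h2 ls hls).fixGF_mul_prod hV, ← ofInts_eq_of_agree (h3 ls hls), ofInts_mulAll]
        ring
      have h6 : ((Int.ofNat (classSize V ls) : ℤ) : ℚ) = classSize V ls := by simp
      rw [totalNumerator, ofInts_addCoeffs, ← ih ht, ofInts_map_mul, ofInts_mulCoeffs, ← h5, h6,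
        List.map_cons, List.sum_cons]
      ring
  have hfac : ((Int.ofNat V.factorial : ℤ) : ℚ) = V.factorial := by simp
  have h7 : C (V.factorial : ℚ) * (columnGF V * ofInts q) =
      C (V.factorial : ℚ) * ofInts num := by
    rw [← mul_assoc, factorial_mul_columnGF, h1.sum_fixGF, hsum _ fun _ => id,
      ofInts_eq_of_agree h4, ofInts_map_mul, hfac]
  refine mul_left_cancel₀ ?_ h7
  rw [Ne, map_eq_zero_iff _ (C_injective (R := ℚ))]
  exact_mod_cast V.factorial_ne_zero

/-- The first coefficients of a quotient of polynomials `num / q` are those of any polynomial `a`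
for which `a * q` and `num` agree up to the corresponding degree. -/
theorem map_count_eq {V : ℕ} {q num : List ℤ} (h : columnGF V * ofInts q = ofInts num)
    (hq : q.headD 0 ≠ 0) {n : ℕ} {a : List ℕ} (hn : a.length = n)
    (ha : ∀ i < n, (mulCoeffs q (a.map Int.ofNat)).getD i 0 = num.getD i 0) :
    (List.range n).map (count V) = a := by
  subst hn
  have hq0 : constantCoeff (ofInts q) ≠ 0 := by
    rw [← coeff_zero_eq_constantCoeff_apply, coeff_ofInts]
    cases q with
    | nil => simp at hq
    | cons b q => simpa using hq
  have h1 : X ^ a.length ∣ columnGF V - ofInts (a.map Int.ofNat) := by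
    have h2 : X ^ a.length ∣ (columnGF V - ofInts (a.map Int.ofNat)) * ofInts q := by
      rw [X_pow_dvd_iff]
      intro i hi
      rw [sub_mul, h, mul_comm, ← ofInts_mulCoeffs, map_sub, coeff_ofInts, coeff_ofInts, ha i hi,
        sub_self]
    have h3 := h2.mul_right (ofInts q)⁻¹
    rwa [mul_assoc, PowerSeries.mul_inv_cancel _ hq0, mul_one] at h3
  refine List.ext_getElem (by simp) fun i _ hi => ?_
  have h4 := X_pow_dvd_iff.1 h1 i hi
  rw [map_sub, sub_eq_zero, columnGF, coeff_mk, coeff_ofInts,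
    List.getD_eq_getElem _ _ (by simpa using hi), List.getElem_map,
    Int.ofNat_eq_natCast] at h4
  rw [List.getElem_map, List.getElem_range]
  exact_mod_cast h4

theorem coe_ofCoeffs (l : List ℤ) :
    ((ofCoeffs (l.map fun a : ℤ => (a : ℚ)) : Polynomial ℚ) : PowerSeries ℚ) = ofInts l := by
  induction l with
  | nil => simp [ofCoeffs, ofInts]
  | cons a l ih =>
    rw [ofInts, ← ih, ofCoeffs, List.map_cons, List.foldr_cons, ← ofCoeffs, Polynomial.coe_add,
      Polynomial.coe_mul, Polynomial.coe_C, Polynomial.coe_X]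

/-! ### The data for two, three, five, six and seven vertices -/

/-- The coefficients of `p5`. -/
def coeffs5 : List ℤ :=
  [3, 5, 12, 17, 26, 27, 35, 28, 38, 30, 39, 37, 34, 24, 15, 3, -7, -9, -8, -1, 4, 6, 5, 3, -2,
   -2, -2, -1, 0, 1]

theorem coe_p5 : (p5 : PowerSeries ℚ) = ofInts coeffs5 := by
  rw [← coe_ofCoeffs]
  simp [p5, coeffs5]

/-- The coefficients of `p6`. -/
def coeffs6 : List ℤ :=
  [6, 11, 35, 70, 134, 217, 348, 533, 726, 1038, 1290, 1629, 1810, 2040, 1976, 1984, 1696,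
   1542, 1206, 1050, 787, 636, 474, 273, 169, -11, -31, -97, -44, -8, 33, 63, 32, 38, -17, -14,
   -31, -8, -5, 8, 11, 4, 3, -4, 0, -3, 0, 1]

theorem coe_p6 : (p6 : PowerSeries ℚ) = ofInts coeffs6 := by
  rw [← coe_ofCoeffs]
  simp [p6, coeffs6]

/-- The coefficients of `p7`. -/
def coeffs7 : List ℤ :=
  [-11, -48, -188, -570, -1526, -3675, -8284, -17431, -35005, -66742, -121908, -213342,
   -359515, -583522, -916091, -1391716, -2051981, -2938963, -4097420, -5564508, -7373793,
   -9539279, -12063528, -14919997, -18064473, -21418776, -24890827, -28355984, -31688266,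
   -34742272, -37387611, -39493274, -40963946, -41717383, -41723196, -40973187, -39511812,
   -37405689, -34764514, -31705308, -28372262, -24898844, -21423490, -18060699, -14913079,
   -12050303, -9525196, -7357519, -5550815, -4085547, -2932089, -2048825, -1393454, -920594,
   -590477, -366935, -220705, -128024, -71511, -37993, -18932, -8318, -2668, 247, 1501, 1827,
   1523, 980, 357, -99, -369, -387, -247, -23, 152, 230, 205, 118, 15, -61, -88, -74, -33, 3,
   26, 28, 19, 5, -4, -7, -5, -1, 1, 1]

theorem coe_p7 : (p7 : PowerSeries ℚ) = ofInts coeffs7 := by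
  rw [← coe_ofCoeffs]
  simp [p7, coeffs7]

/-- The factors of the denominator of `columnGF 2`, with their exponents. -/
def factors2 : List (List ℤ × ℕ) := [([1, -1], 1)]

/-- The factors of the denominator of `columnGF 3`, with their exponents. -/
def factors3 : List (List ℤ × ℕ) := [([-1, 1], 3), ([1, 1], 1), ([1, 1, 1], 1)]

/-- The factors of the denominator of `columnGF 5`, with their exponents. -/
def factors5 : List (List ℤ × ℕ) := [([-1, 1], 10), ([1, 1, 1], 3), ([1, 1], 4), ([1, -1, 1], 1),
  ([1, 1, 1, 1, 1], 2), ([1, 0, 1], 2)]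

/-- The factors of the denominator of `columnGF 6`, with their exponents. -/
def factors6 : List (List ℤ × ℕ) := [([-1, 1], 15), ([1, 1], 6), ([1, 0, 1], 3), ([1, 1, 1], 5),
  ([1, -1, 1], 2), ([1, 1, 1, 1, 1], 3)]

/-- The factors of the denominator of `columnGF 7`, with their exponents. -/
def factors7 : List (List ℤ × ℕ) := [([-1, 1], 21), ([1, 1, 1, 1, 1], 4), ([1, 1, 1], 7),
  ([1, 1], 9), ([1, 0, 1], 4), ([1, -1, 1], 3), ([1, 0, -1, 0, 1], 1), ([1, -1, 1, -1, 1], 1),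
  ([1, 1, 1, 1, 1, 1, 1], 3)]

theorem isCertificate_two :
    IsCertificate 2 [[], [2]] (prodPow factors2) (shiftCoeffs 1 [1]) := by
  decide +kernel

theorem isCertificate_three :
    IsCertificate 3 [[], [2], [3]] (prodPow factors3) (shiftCoeffs 2 [-1, -1, 0, 1]) := by
  decide +kernel

theorem isCertificate_five :
    IsCertificate 5 [[], [2], [2, 2], [3], [3, 2], [4], [5]] (prodPow factors5)
      (shiftCoeffs 4 coeffs5) := by
  decide +kernel

theorem isCertificate_six :
    IsCertificate 6 [[], [2], [2, 2], [2, 2, 2], [3], [3, 2], [3, 3], [4], [4, 2], [5], [6]]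
      (prodPow factors6) (shiftCoeffs 5 (coeffs6.map Int.neg)) := by
  decide +kernel

theorem isCertificate_seven :
    IsCertificate 7 [[], [2], [2, 2], [2, 2, 2], [3], [3, 2], [3, 2, 2], [3, 3], [4], [4, 2],
      [4, 3], [5], [5, 2], [6], [7]] (prodPow factors7) (shiftCoeffs 6 coeffs7) := by
  decide +kernel

theorem columnGF_eq_mul_inv {V : ℕ} [NeZero V] {types : List (List ℕ)} {q num : List ℤ}
    (h : IsCertificate V types q num) {Q N : PowerSeries ℚ} (hQ : ofInts q = Q)
    (hN : ofInts num = N) (h0 : constantCoeff Q ≠ 0) : columnGF V = N * Q⁻¹ := by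
  rw [PowerSeries.eq_mul_inv_iff_mul_eq h0, ← hQ, ← hN, h.columnGF_mul]

end ConnectedMultigraphs

open ConnectedMultigraphs PowerSeries in
theorem mainTheorem2 :
    (∀ V ∈ ({2, 3, 5, 6, 7} : Finset ℕ), columnGF V = polyaSum V) ∧
    (columnGF 2 = X * (1 - X)⁻¹ ∧
      (List.range 6).map (count 2) = [0, 1, 1, 1, 1, 1]) ∧
    (columnGF 3 = (X ^ 3 - X - 1) * X ^ 2 *
        ((-1 + X) ^ 3 * (X + 1) * (X ^ 2 + X + 1))⁻¹ ∧
      (List.range 15).map (count 3) = [0, 0, 1, 2, 3, 4, 6, 7, 9, 11, 13, 15, 18, 20, 23]) ∧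
    (columnGF 5 = X ^ 4 * (p5 : PowerSeries ℚ) *
        ((-1 + X) ^ 10 * (X ^ 2 + X + 1) ^ 3 * (X + 1) ^ 4 * (X ^ 2 - X + 1) *
          (X ^ 4 + X ^ 3 + X ^ 2 + X + 1) ^ 2 * (X ^ 2 + 1) ^ 2)⁻¹ ∧
      (List.range 14).map (count 5) =
        [0, 0, 0, 0, 3, 11, 34, 85, 193, 396, 771, 1411, 2490, 4221]) ∧
    (columnGF 6 = -(X ^ 5 * (p6 : PowerSeries ℚ) *
        ((-1 + X) ^ 15 * (X + 1) ^ 6 * (X ^ 2 + 1) ^ 3 * (X ^ 2 + X + 1) ^ 5 *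
          (X ^ 2 - X + 1) ^ 2 * (X ^ 4 + X ^ 3 + X ^ 2 + X + 1) ^ 3)⁻¹) ∧
      (List.range 16).map (count 6) =
        [0, 0, 0, 0, 0, 6, 29, 110, 348, 969, 2445, 5746, 12736, 26843, 54256, 105669]) ∧
    (columnGF 7 = X ^ 6 * (p7 : PowerSeries ℚ) *
        ((-1 + X) ^ 21 * (X ^ 4 + X ^ 3 + X ^ 2 + X + 1) ^ 4 * (X ^ 2 + X + 1) ^ 7 *
          (X + 1) ^ 9 * (X ^ 2 + 1) ^ 4 * (X ^ 2 - X + 1) ^ 3 *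
          (X ^ 4 - X ^ 2 + 1) * (X ^ 4 - X ^ 3 + X ^ 2 - X + 1) *
          (X ^ 6 + X ^ 5 + X ^ 4 + X ^ 3 + X ^ 2 + X + 1) ^ 3)⁻¹ ∧
      (List.range 15).map (count 7) =
        [0, 0, 0, 0, 0, 0, 11, 70, 339, 1318, 4457, 13572, 38201, 100622, 251078]) := by
  refine ⟨fun V _ => columnGF_eq_polyaSum V, ⟨?_, ?_⟩, ⟨?_, ?_⟩, ⟨?_, ?_⟩, ⟨?_, ?_⟩, ?_, ?_⟩
  · refine columnGF_eq_mul_inv isCertificate_two ?_ ?_ (by simp)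
    · simp [ofInts_prodPow, factors2, ofInts]
      ring
    · simp [ofInts_shiftCoeffs, ofInts]
  · refine map_count_eq isCertificate_two.columnGF_mul (by decide +kernel) rfl ?_
    decide +kernel
  · refine columnGF_eq_mul_inv isCertificate_three ?_ ?_ (by simp)
    · simp [ofInts_prodPow, factors3, ofInts]
      ring
    · simp [ofInts_shiftCoeffs, ofInts]
      ring
  · refine map_count_eq isCertificate_three.columnGF_mul (by decide +kernel) rfl ?_
    decide +kernel
  · refine columnGF_eq_mul_inv isCertificate_five ?_ ?_ (by simp)
    · simp [ofInts_prodPow, factors5, ofInts]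
      ring
    · rw [ofInts_shiftCoeffs, coe_p5]
  · refine map_count_eq isCertificate_five.columnGF_mul (by decide +kernel) rfl ?_
    decide +kernel
  · rw [← neg_mul]
    refine columnGF_eq_mul_inv isCertificate_six ?_ ?_ (by simp)
    · simp [ofInts_prodPow, factors6, ofInts]
      ring
    · rw [ofInts_shiftCoeffs, coe_p6, ofInts_map_neg, mul_neg]
  · refine map_count_eq isCertificate_six.columnGF_mul (by decide +kernel) rfl ?_
    decide +kernel
  · refine columnGF_eq_mul_inv isCertificate_seven ?_ ?_ (by simp)
    · simp [ofInts_prodPow, factors7, ofInts]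
      ring
    · rw [ofInts_shiftCoeffs, coe_p7]
  · refine map_count_eq isCertificate_seven.columnGF_mul (by decide +kernel) rfl ?_
    decide +kernel
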